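/- Let $\rho$ be a Borel probability measure on $\mathbb R^d$ and let $p\ge 8$ be a multiple of $4$. Suppose $\rho$ has order-$p$ moment bound $M$, meaning $\mathbb E_\rho\|X-\mathbb E_\rho X\|_2^l\le M$ (with these moments existing) for $1\le l\le p$. Let $0<\sigma_1\le\sigma_2$ with $\sigma_1\le 1$, let $c\le 1/2$ be real, let $k\in\mathbb N$ and $\delta>0$. For Gaussian mixture parameters $(\alpha,\Theta)=\{(\alpha_i,\mu_i,\Sigma_i)\}_{i=1}^n$ put $$\phi_{\mathrm g}(x;(\alpha,\Theta)):=\ln\Big(\sum_{i=1}^n\alpha_i p_{\mu_i,\Sigma_i}(x)\Big),\qquad p_{\mu,\Sigma}(x)=\frac{1}{\sqrt{(2\pi)^d|\Sigma|}}\exp\Big(-\tfrac12(x-\mu)^{\top}\Sigma^{-1}(x-\mu)\Big).$$ For a probability measure $\nu$, let $\mathcal S(\nu)$ be the set of all $(\alpha,\Theta)$ with at most $k$ components, $\alpha_i\ge0$, $\sum_i\alpha_i=1$, $\sigma_1I\preceq\Sigma_i\preceq\sigma_2I$ for every $i$, and $\mathbb E_\nu\,\phi_{\mathrm g}(X;(\alpha,\Theta))\ge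 c$. There are universal constants $C$ and $N$ such that, for all data as above, the following holds. If $$m\ge\max\Big\{\big(p/(2^{p/4+2}e)\big)^2,\ 8\ln(1/\delta),\ d^2\ln(\pi\sigma_2)^2\ln(1/\delta)\Big\},$$ then with probability at least $1-5\delta$ over the draw of an i.i.d. sample of size $m$ from $\rho$, with empirical measure $\hat\rho$, every $(\alpha,\Theta)\in\mathcal S(\hat\rho)\cup\mathcal S(\rho)$ has $\phi_{\mathrm g}(\cdot;(\alpha,\Theta))$ integrable under $\rho$ and satisfies $$\Big|\int\phi_{\mathrm g}(x;(\alpha,\Theta))\,d\rho(x)-\int\phi_{\mathrm g}(x;(\alpha,\Theta))\,d\hat\rho(x)\Big|\le K\,m^{-1/2+3/p}\Big(1+\sqrt{\ln m+\ln(1/\delta)}+(1/\delta)^{4/p}\Big),$$ where $K=C\,\big(1+p+d+k+|c|+M+\sigma_2/\sigma_1+1/\sigma_1\big)^{N}$ depends only polynomially on the listed parameters and on no sample-dependent quantity. -/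

import Mathlib

open MeasureTheory

noncomputable section

/-- `ρ` has order-`p` moment bound `M` with respect to the Euclidean norm: the central absolute
moments of orders `1, …, p` exist and are at most `M`.  (Integrability at `l = 1` makes the mean
`∫ y, y ∂ρ` a genuine expectation.) -/
def HasMomentBound {d : ℕ} (ρ : Measure (EuclideanSpace ℝ (Fin d))) (p : ℕ) (M : ℝ) : Prop :=
  ∀ l : ℕ, 1 ≤ l → l ≤ p →
    Integrable (fun x => ‖x - ∫ y, y ∂ρ‖ ^ l) ρ ∧ ∫ x, ‖x - ∫ y, y ∂ρ‖ ^ l ∂ρ ≤ M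

/-- The empirical measure `(1/m) ∑ⱼ δ_{xⱼ}` of a sample of size `m`. -/
def empiricalMeasure {d m : ℕ} (x : Fin m → EuclideanSpace ℝ (Fin d)) :
    Measure (EuclideanSpace ℝ (Fin d)) :=
  (m : ENNReal)⁻¹ • ∑ j, Measure.dirac (x j)

/-- The Gaussian density on `ℝᵈ` with mean `μ` and covariance matrix `S`. -/
def gaussianDensity {d : ℕ} (μ : EuclideanSpace ℝ (Fin d)) (S : Matrix (Fin d) (Fin d) ℝ)
    (x : EuclideanSpace ℝ (Fin d)) : ℝ :=
  1 / Real.sqrt ((2 * Real.pi) ^ d * S.det) *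
    Real.exp (-(1 / 2) * ((x - μ).ofLp ⬝ᵥ (S⁻¹.mulVec (x - μ).ofLp)))

/-- Raw parameters `(α, Θ)` of a mixture with `size` Gaussian components on `ℝᵈ`; the constraints
on the weights and covariances are imposed in `mogClass`. -/
structure MixtureParams (d : ℕ) where
  /-- number of components -/
  size : ℕ
  /-- mixture weights -/
  weight : Fin size → ℝ
  /-- component means -/
  mean : Fin size → EuclideanSpace ℝ (Fin d)
  /-- component covariances -/
  cov : Fin size → Matrix (Fin d) (Fin d) ℝ

/-- The Gaussian mixture score at a point: the logarithm of the mixture density. -/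
def mixtureScore {d : ℕ} (θ : MixtureParams d) (x : EuclideanSpace ℝ (Fin d)) : ℝ :=
  Real.log (∑ i, θ.weight i * gaussianDensity (θ.mean i) (θ.cov i) x)

/-- Parameters of mixtures with at most `k` components, weights in the simplex, covariances with
`σ₁ I ⪯ Σᵢ ⪯ σ₂ I`, whose expected log-likelihood under `ν` is at least `c`.  (The score is bounded
above on this class, so an expectation `≥ c` includes integrability.) -/
def mogClass {d : ℕ} (ν : Measure (EuclideanSpace ℝ (Fin d))) (c : ℝ) (k : ℕ) (σ₁ σ₂ : ℝ) :
    Set (MixtureParams d) :=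
  {θ | θ.size ≤ k ∧
    (∀ i, 0 ≤ θ.weight i) ∧ ∑ i, θ.weight i = 1 ∧
    (∀ i, (θ.cov i - σ₁ • (1 : Matrix (Fin d) (Fin d) ℝ)).PosSemidef ∧
      (σ₂ • (1 : Matrix (Fin d) (Fin d) ℝ) - θ.cov i).PosSemidef) ∧
    Integrable (mixtureScore θ) ν ∧ c ≤ ∫ x, mixtureScore θ x ∂ν}

end

/-! All parameters are dominated by a single number `Q`, and `x₀` denotes the mean of `ρ`. A mixture
score is at most `Q ^ 2` everywhere. If its expectation under `ν` is at least `c` and `ν` gives mass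
at least one half to the ball of radius `4 * Q` about `x₀`, then the score is at least `-5 * Q ^ 2`
at some point of that ball (`exists_mem_le_score`). By pigeonhole one component then has weight
bounded below and mean close to `x₀`, and this component alone forces quadratic growth `|score x| ≤
100 * Q ^ 4 * (1 + ‖x - x₀‖ ^ 2)` (`abs_score_le`). Markov's inequality for `ρ` and Hoeffding's for
the empirical measure give both the required mass, so the two classes are treated together.

Take `R ^ p = (M + 1) * m / δ`. With probability at least `1 - δ` the whole sample lies in the ball
of radius `R`, and outside it quadratic growth makes the `ρ`-integral of order `R ^ (-p / 2) ≤ m ^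
(-1 / 2)`.

On the ball scores are bounded by a multiple of `R ^ 2`, but the class is not compact: weights may
vanish and means may escape to infinity. A component below `exp (-T)` on the whole ball is therefore
replaced by the constant `exp (-T)`. The others have controlled parameters, so every score is
uniformly close to a log-sum-exp of `k` quadratic polynomials with bounded coefficients
(`exists_logSumExpFeatures_approx`). Log-sum-exp is nonexpansive, so the coefficients can be rounded
to a finite grid, and Hoeffding with a union bound gives a deviation of order `R ^ 2 * √(L / m)`,
where `L` is logarithmic in the grid size.

Put `X = m ^ (1 / p)` and `Y = (1 / δ) ^ (1 / p)`. Then `R ^ 2` contributes `X ^ 2 * Y ^ 2`, while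
`log m ≤ p * X` and `log (1 / δ) ≤ p * Y` bound `√L` by a multiple of `X * Y ^ 2`. The product `X ^
3 * Y ^ 4 / √m` is the stated rate. -/

open MeasureTheory

noncomputable section

/-! ### Spectral bounds for covariance matrices and their inverses -/

section MatrixBounds

variable {d : ℕ} {S : Matrix (Fin d) (Fin d) ℝ} {σ₁ σ₂ : ℝ}

lemma mul_dotProduct_self_le_of_posSemidef_sub
    (h : (S - σ₁ • (1 : Matrix (Fin d) (Fin d) ℝ)).PosSemidef) (v : Fin d → ℝ) :
    σ₁ * (v ⬝ᵥ v) ≤ v ⬝ᵥ S.mulVec v := by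
  have := h.dotProduct_mulVec_nonneg v
  simp only [star_trivial, Matrix.sub_mulVec, Matrix.smul_mulVec, Matrix.one_mulVec,
    dotProduct_sub, dotProduct_smul, smul_eq_mul] at this
  linarith

lemma dotProduct_mulVec_le_of_posSemidef_sub
    (h : (σ₂ • (1 : Matrix (Fin d) (Fin d) ℝ) - S).PosSemidef) (v : Fin d → ℝ) :
    v ⬝ᵥ S.mulVec v ≤ σ₂ * (v ⬝ᵥ v) := by
  have := h.dotProduct_mulVec_nonneg v
  simp only [star_trivial, Matrix.sub_mulVec, Matrix.smul_mulVec, Matrix.one_mulVec,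
    dotProduct_sub, dotProduct_smul, smul_eq_mul] at this
  linarith

lemma posDef_of_posSemidef_sub (hσ : 0 < σ₁)
    (h : (S - σ₁ • (1 : Matrix (Fin d) (Fin d) ℝ)).PosSemidef) : S.PosDef := by
  have h1 : (σ₁ • (1 : Matrix (Fin d) (Fin d) ℝ)).PosDef := Matrix.PosDef.one.smul hσ
  simpa using h1.add_posSemidef h

lemma dotProduct_self_eigenvectorBasis (hS : S.IsHermitian) (i : Fin d) :
    (hS.eigenvectorBasis i).ofLp ⬝ᵥ (hS.eigenvectorBasis i).ofLp = 1 := by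
  have h := hS.eigenvectorBasis.orthonormal.1 i
  have h2 := EuclideanSpace.real_norm_sq_eq (hS.eigenvectorBasis i)
  rw [h] at h2
  simp only [dotProduct, ← pow_two]
  linarith

/-- Each eigenvalue is the value of the quadratic form at a unit eigenvector, hence at least `σ₁`.
-/
lemma pow_le_det_of_posSemidef_sub (hσ : 0 < σ₁)
    (h : (S - σ₁ • (1 : Matrix (Fin d) (Fin d) ℝ)).PosSemidef) : σ₁ ^ d ≤ S.det := by
  have hS := (posDef_of_posSemidef_sub hσ h).isHermitian
  rw [hS.det_eq_prod_eigenvalues]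
  have : σ₁ ^ d = ∏ _i : Fin d, σ₁ := by simp
  rw [this]
  refine Finset.prod_le_prod (fun _ _ => hσ.le) fun i _ => ?_
  have h1 := mul_dotProduct_self_le_of_posSemidef_sub h (hS.eigenvectorBasis i).ofLp
  rw [dotProduct_self_eigenvectorBasis] at h1
  simpa [hS.eigenvalues_eq i] using h1

lemma det_le_pow_of_posSemidef_sub (hσ : 0 < σ₁)
    (h : (S - σ₁ • (1 : Matrix (Fin d) (Fin d) ℝ)).PosSemidef)
    (h' : (σ₂ • (1 : Matrix (Fin d) (Fin d) ℝ) - S).PosSemidef) : S.det ≤ σ₂ ^ d := by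
  have hS := (posDef_of_posSemidef_sub hσ h).isHermitian
  rw [hS.det_eq_prod_eigenvalues]
  have : σ₂ ^ d = ∏ _i : Fin d, σ₂ := by simp
  rw [this]
  refine Finset.prod_le_prod (fun i _ => ?_) fun i _ => ?_
  · exact ((posDef_of_posSemidef_sub hσ h).eigenvalues_pos i).le
  have h1 := dotProduct_mulVec_le_of_posSemidef_sub h' (hS.eigenvectorBasis i).ofLp
  rw [dotProduct_self_eigenvectorBasis] at h1
  simpa [hS.eigenvalues_eq i] using h1

lemma mulVec_inv_mulVec_of_posDef (hS : S.PosDef) (v : Fin d → ℝ) :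
    S.mulVec (S⁻¹.mulVec v) = v := by
  rw [Matrix.mulVec_mulVec, Matrix.mul_nonsing_inv _ hS.det_pos.ne'.isUnit, Matrix.one_mulVec]

lemma dotProduct_inv_mulVec_nonneg (hS : S.PosDef) (v : Fin d → ℝ) :
    0 ≤ v ⬝ᵥ S⁻¹.mulVec v := by
  simpa using hS.inv.posSemidef.dotProduct_mulVec_nonneg v

/-- With `u = S⁻¹ v`, expand `0 ≤ |v - σ₁ u|²` and use `σ₁ |u|² ≤ u ⬝ S u = u ⬝ v`. -/
lemma dotProduct_inv_mulVec_le (hσ : 0 < σ₁)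
    (h : (S - σ₁ • (1 : Matrix (Fin d) (Fin d) ℝ)).PosSemidef) (v : Fin d → ℝ) :
    v ⬝ᵥ S⁻¹.mulVec v ≤ (v ⬝ᵥ v) / σ₁ := by
  have hS := posDef_of_posSemidef_sub hσ h
  set u := S⁻¹.mulVec v with hu
  have h1 := mul_dotProduct_self_le_of_posSemidef_sub h u
  rw [mulVec_inv_mulVec_of_posDef hS] at h1
  have h2 : 0 ≤ (v - σ₁ • u) ⬝ᵥ (v - σ₁ • u) := by
    simp only [dotProduct]; exact Finset.sum_nonneg fun i _ => mul_self_nonneg _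
  simp only [sub_dotProduct, dotProduct_sub, smul_dotProduct, dotProduct_smul, smul_eq_mul,
    dotProduct_comm u v] at h2 h1
  rw [le_div_iff₀ hσ]
  nlinarith

/-- With `u = S⁻¹ v`, expand the `S`-form at `v - σ₂ u`, which is nonnegative, and use `v ⬝ S v ≤ σ₂
|v|²`. -/
lemma le_dotProduct_inv_mulVec (hσ : 0 < σ₁) (hσ₂ : 0 < σ₂)
    (h : (S - σ₁ • (1 : Matrix (Fin d) (Fin d) ℝ)).PosSemidef)
    (h' : (σ₂ • (1 : Matrix (Fin d) (Fin d) ℝ) - S).PosSemidef) (v : Fin d → ℝ) :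
    (v ⬝ᵥ v) / σ₂ ≤ v ⬝ᵥ S⁻¹.mulVec v := by
  have hS := posDef_of_posSemidef_sub hσ h
  set u := S⁻¹.mulVec v with hu
  have h0 := mul_dotProduct_self_le_of_posSemidef_sub h (v - σ₂ • u)
  have h0' : 0 ≤ (v - σ₂ • u) ⬝ᵥ (v - σ₂ • u) := by
    simp only [dotProduct]; exact Finset.sum_nonneg fun i _ => mul_self_nonneg _
  have h1 := dotProduct_mulVec_le_of_posSemidef_sub h' v
  have hsymm : u ⬝ᵥ S.mulVec v = v ⬝ᵥ v := by
    have : S.transpose = S := by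
      have h := hS.isHermitian.eq
      rwa [Matrix.conjTranspose_eq_transpose_of_trivial] at h
    rw [Matrix.dotProduct_mulVec, ← Matrix.mulVec_transpose, this,
      mulVec_inv_mulVec_of_posDef hS]
  have h2 : 0 ≤ (v - σ₂ • u) ⬝ᵥ S.mulVec (v - σ₂ • u) :=
    le_trans (mul_nonneg hσ.le h0') h0
  simp only [Matrix.mulVec_sub, Matrix.mulVec_smul, sub_dotProduct, dotProduct_sub,
    smul_dotProduct, dotProduct_smul, smul_eq_mul, hu ▸ mulVec_inv_mulVec_of_posDef hS v,
    hsymm, dotProduct_comm u v] at h2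
  rw [div_le_iff₀ hσ₂]
  nlinarith

/-- Positivity of the inverse form at `e_a ± e_b` bounds an off-diagonal entry by the mean of two
diagonal ones. -/
lemma abs_inv_apply_le (hσ : 0 < σ₁)
    (h : (S - σ₁ • (1 : Matrix (Fin d) (Fin d) ℝ)).PosSemidef) (a b : Fin d) :
    |S⁻¹ a b| ≤ 1 / σ₁ := by
  have hS := posDef_of_posSemidef_sub hσ h
  have hsym : S⁻¹ b a = S⁻¹ a b := by
    simpa using hS.inv.isHermitian.apply a b
  have key : ∀ a b, Pi.single a 1 ⬝ᵥ S⁻¹.mulVec (Pi.single b 1) = S⁻¹ a b := by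
    intro a b; simp
  have e1 := dotProduct_inv_mulVec_nonneg hS (Pi.single a 1 + Pi.single b 1)
  have e2 := dotProduct_inv_mulVec_nonneg hS (Pi.single a 1 - Pi.single b 1)
  have e3 := dotProduct_inv_mulVec_le hσ h (Pi.single a 1)
  have e4 := dotProduct_inv_mulVec_le hσ h (Pi.single b 1)
  simp only [Matrix.mulVec_add, Matrix.mulVec_sub, add_dotProduct, dotProduct_add,
    sub_dotProduct, dotProduct_sub, key, hsym] at e1 e2 e3 e4
  simp only [single_dotProduct, Pi.single_eq_same, one_mul] at e3 e4
  rw [abs_le]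
  constructor <;> linarith

end MatrixBounds

/-! ### Hoeffding bounds for finite classes -/

section Concentration

open ProbabilityTheory

variable {E : Type*} [MeasurableSpace E]

/-- One-sided Hoeffding inequality for a sum over an i.i.d. sample. -/
lemma measure_pi_sum_sub_integral_ge_le (ρ : Measure E) [IsProbabilityMeasure ρ] {m : ℕ}
    {g : E → ℝ} (hg : Measurable g) {b s : ℝ} (hb : ∀ x, |g x| ≤ b)
    (hs : 0 ≤ s) :
    (Measure.pi fun _ : Fin m => ρ).real {x | s ≤ ∑ j, (g (x j) - ∫ y, g y ∂ρ)} ≤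
      Real.exp (-s ^ 2 / (2 * (m * b ^ 2))) := by
  have hX := hasSubgaussianMGF_of_mem_Icc (μ := ρ) (a := -b) (b := b) hg.aemeasurable
    (Filter.Eventually.of_forall fun x => ⟨(abs_le.1 (hb x)).1, (abs_le.1 (hb x)).2⟩)
  have hind : iIndepFun (fun (j : Fin m) (x : Fin m → E) => g (x j) - ∫ y, g y ∂ρ)
      (Measure.pi fun _ : Fin m => ρ) :=
    iIndepFun_pi (X := fun (_ : Fin m) (y : E) => g y - ∫ y, g y ∂ρ)
      fun _ => (hg.sub_const _).aemeasurable
  have hsub : ∀ j : Fin m, HasSubgaussianMGF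
      (fun x : Fin m → E => g (x j) - ∫ y, g y ∂ρ) ((‖b - -b‖₊ / 2) ^ 2)
      (Measure.pi fun _ : Fin m => ρ) := by
    intro j
    have hmap : (Measure.pi fun _ : Fin m => ρ).map (fun x => x j) = ρ :=
      (measurePreserving_eval (fun _ : Fin m => ρ) j).map_eq
    rw [← hmap] at hX
    have := HasSubgaussianMGF.of_map (Y := fun x : Fin m → E => x j)
      (measurable_pi_apply j).aemeasurable hX
    rw [hmap] at this
    exact this
  have := HasSubgaussianMGF.measure_sum_ge_le_of_iIndepFun hind (s := Finset.univ)
    (fun j _ => hsub j) hs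
  refine this.trans (le_of_eq ?_)
  congr 2
  simp only [Finset.sum_const, Finset.card_univ, Fintype.card_fin, nsmul_eq_mul]
  push_cast
  rw [Real.norm_eq_abs, show b - -b = 2 * b by ring, abs_mul, div_pow, mul_pow, sq_abs, sq_abs]
  norm_num

/-- Two-sided Hoeffding inequality for an empirical mean. -/
lemma measure_pi_abs_integral_sub_mean_ge_le (ρ : Measure E) [IsProbabilityMeasure ρ] {m : ℕ}
    (hm : 0 < m) {g : E → ℝ} (hg : Measurable g) {b t : ℝ} (hb : ∀ x, |g x| ≤ b)
    (ht : 0 ≤ t) :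
    (Measure.pi fun _ : Fin m => ρ) {x | t ≤ |∫ y, g y ∂ρ - (m : ℝ)⁻¹ * ∑ j, g (x j)|} ≤
      ENNReal.ofReal (2 * Real.exp (-(m * t ^ 2) / (2 * b ^ 2))) := by
  have hm' : (0 : ℝ) < m := by exact_mod_cast hm
  have h1 := measure_pi_sum_sub_integral_ge_le ρ (m := m) hg hb (s := m * t) (by positivity)
  have h2 := measure_pi_sum_sub_integral_ge_le ρ (m := m) hg.neg (b := b) (s := m * t)
    (by simpa using hb) (by positivity)
  have hexp : -(m * t) ^ 2 / (2 * (m * b ^ 2)) = -(m * t ^ 2) / (2 * b ^ 2) := by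
    rw [show -(m * t) ^ 2 = (m : ℝ) * (-(m * t ^ 2)) by ring,
      show 2 * (m * b ^ 2) = (m : ℝ) * (2 * b ^ 2) by ring, mul_div_mul_left _ _ hm'.ne']
  rw [hexp] at h1 h2
  have hsub : {x : Fin m → E | t ≤ |∫ y, g y ∂ρ - (m : ℝ)⁻¹ * ∑ j, g (x j)|} ⊆
      {x | m * t ≤ ∑ j, (g (x j) - ∫ y, g y ∂ρ)} ∪
        {x | m * t ≤ ∑ j, ((-g) (x j) - ∫ y, (-g) y ∂ρ)} := by
    intro x hx
    have hx' : t ≤ |∫ y, g y ∂ρ - (m : ℝ)⁻¹ * ∑ j, g (x j)| := hx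
    have hS : ∑ j, g (x j) = m * ((m : ℝ)⁻¹ * ∑ j, g (x j)) := by
      rw [← mul_assoc, mul_inv_cancel₀ hm'.ne', one_mul]
    rcases le_abs.1 hx' with h | h
    · right
      have := mul_le_mul_of_nonneg_left h hm'.le
      change m * t ≤ ∑ j, ((-g) (x j) - ∫ y, (-g) y ∂ρ)
      simp only [Pi.neg_apply, integral_neg, Finset.sum_sub_distrib, Finset.sum_neg_distrib,
        Finset.sum_const, Finset.card_univ, Fintype.card_fin, nsmul_eq_mul]
      linarith
    · left
      have := mul_le_mul_of_nonneg_left h hm'.le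
      change m * t ≤ ∑ j, (g (x j) - ∫ y, g y ∂ρ)
      simp only [Finset.sum_sub_distrib, Finset.sum_const, Finset.card_univ, Fintype.card_fin,
        nsmul_eq_mul]
      linarith
  rw [← ofReal_measureReal]
  apply ENNReal.ofReal_le_ofReal
  calc _ ≤ _ := measureReal_mono hsub
    _ ≤ _ := measureReal_union_le _ _
    _ ≤ _ := add_le_add h1 h2
    _ = _ := by ring

/-- Uniform deviation over a finite class of bounded functions. -/
lemma exists_measurableSet_finite_class_deviation (ρ : Measure E) [IsProbabilityMeasure ρ]
    {m : ℕ} (hm : 0 < m) {ι : Type*} [Fintype ι] {g : ι → E → ℝ} (hg : ∀ i, Measurable (g i))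
    {b δ L : ℝ} (hbpos : 0 < b) (hb : ∀ i x, |g i x| ≤ b) (hL : 0 ≤ L)
    (hcard : 2 * (Fintype.card ι : ℝ) ≤ δ * Real.exp L) :
    ∃ G : Set (Fin m → E), MeasurableSet G ∧
      (Measure.pi fun _ : Fin m => ρ) Gᶜ ≤ ENNReal.ofReal δ ∧
      ∀ x ∈ G, ∀ i, |∫ y, g i y ∂ρ - (m : ℝ)⁻¹ * ∑ j, g i (x j)| ≤ b * Real.sqrt (2 * L / m) := by
  have hm' : (0 : ℝ) < m := by exact_mod_cast hm
  set t := b * Real.sqrt (2 * L / m) with ht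
  have ht0 : 0 ≤ t := by positivity
  set A : ι → Set (Fin m → E) := fun i => {x | t ≤ |∫ y, g i y ∂ρ - (m : ℝ)⁻¹ * ∑ j, g i (x j)|}
    with hA
  have hAm : ∀ i, MeasurableSet (A i) := by
    intro i
    refine measurableSet_le measurable_const ?_
    have : Measurable fun x : Fin m → E => ∑ j, g i (x j) :=
      Finset.measurable_sum _ fun j _ => (hg i).comp (measurable_pi_apply j)
    exact (measurable_const.sub (this.const_mul _)).abs
  refine ⟨(⋃ i, A i)ᶜ, (MeasurableSet.iUnion hAm).compl, ?_, ?_⟩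
  · rw [compl_compl]
    -- The threshold `t` is chosen so that the Hoeffding exponent is exactly `-L`.
    have hbound : ∀ i, (Measure.pi fun _ : Fin m => ρ) (A i) ≤
        ENNReal.ofReal (2 * Real.exp (-L)) := by
      intro i
      refine (measure_pi_abs_integral_sub_mean_ge_le ρ hm (hg i) (hb i) ht0).trans (le_of_eq ?_)
      congr 3
      rw [ht, mul_pow, Real.sq_sqrt (by positivity)]
      field_simp
    calc _ ≤ ∑ i, (Measure.pi fun _ : Fin m => ρ) (A i) := measure_iUnion_fintype_le _ _
      _ ≤ ∑ _i : ι, ENNReal.ofReal (2 * Real.exp (-L)) := Finset.sum_le_sum fun i _ => hbound i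
      _ = ENNReal.ofReal (Fintype.card ι * (2 * Real.exp (-L))) := by
          rw [Finset.sum_const, nsmul_eq_mul, Finset.card_univ,
            ENNReal.ofReal_mul (Nat.cast_nonneg _), ENNReal.ofReal_natCast]
      _ ≤ ENNReal.ofReal δ := by
          apply ENNReal.ofReal_le_ofReal
          have := mul_le_mul_of_nonneg_right hcard (Real.exp_pos (-L)).le
          rw [mul_assoc δ, ← Real.exp_add, add_neg_cancel, Real.exp_zero] at this
          linarith
  · intro x hx i
    by_contra! hlt
    exact hx (Set.mem_iUnion.2 ⟨i, hlt.le⟩)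

end Concentration

/-! ### Covering log-sum-exps of linear combinations of features -/

section LogSumExp

/-- Log-sum-exp is nonexpansive for the supremum distance. -/
lemma abs_log_sum_exp_sub_le {ι : Type*} [Fintype ι] [Nonempty ι] {u v : ι → ℝ} {ε : ℝ}
    (h : ∀ i, |u i - v i| ≤ ε) :
    |Real.log (∑ i, Real.exp (u i)) - Real.log (∑ i, Real.exp (v i))| ≤ ε := by
  have key : ∀ u v : ι → ℝ, (∀ i, u i ≤ v i + ε) →
      Real.log (∑ i, Real.exp (u i)) ≤ Real.log (∑ i, Real.exp (v i)) + ε := by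
    intro u v h
    have hpos : ∀ u : ι → ℝ, 0 < ∑ i, Real.exp (u i) := fun u =>
      Finset.sum_pos (fun i _ => Real.exp_pos _) Finset.univ_nonempty
    rw [← Real.log_exp ε, ← Real.log_mul (hpos v).ne' (Real.exp_pos _).ne']
    apply Real.log_le_log (hpos u)
    rw [Finset.sum_mul]
    exact Finset.sum_le_sum fun i _ => by rw [← Real.exp_add]; exact Real.exp_le_exp.2 (h i)
  have h1 := key u v fun i => by linarith [(abs_le.1 (h i)).2]
  have h2 := key v u fun i => by linarith [(abs_le.1 (h i)).1]
  rw [abs_le]; constructor <;> linarith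

/-- The log-sum-exp of `k` linear combinations of the features `φ`, with coefficients `w`. -/
def logSumExpFeatures {E ι : Type*} [Fintype ι] {k : ℕ} (φ : ι → E → ℝ) (w : Fin k → ι → ℝ)
    (x : E) : ℝ :=
  Real.log (∑ i, Real.exp (∑ s, w i s * φ s x))

lemma abs_logSumExpFeatures_sub_le {E ι : Type*} [Fintype ι] {k : ℕ} (hk : 0 < k)
    (φ : ι → E → ℝ) {w w' : Fin k → ι → ℝ} {η Φ : ℝ} (hη : 0 ≤ η)
    (hw : ∀ i s, |w i s - w' i s| ≤ η) {x : E}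
    (hφ : ∀ s, |φ s x| ≤ Φ) :
    |logSumExpFeatures φ w x - logSumExpFeatures φ w' x| ≤ Fintype.card ι * (η * Φ) := by
  have : Nonempty (Fin k) := ⟨⟨0, hk⟩⟩
  refine abs_log_sum_exp_sub_le fun i => ?_
  rw [← Finset.sum_sub_distrib]
  refine (Finset.abs_sum_le_sum_abs _ _).trans ?_
  rw [← nsmul_eq_mul, ← Finset.card_univ]
  refine Finset.sum_le_card_nsmul _ _ _ fun s _ => ?_
  rw [← sub_mul, abs_mul]
  exact mul_le_mul (hw i s) (hφ s) (abs_nonneg _) hη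

/-- Rounding to a grid of mesh `η`. -/
lemma exists_grid_approx {W η : ℝ} (hη : 0 < η) {J : ℕ} (hJ : W / η + 1 ≤ J) {w : ℝ}
    (hw : |w| ≤ W) : ∃ j : Fin (2 * J + 1), |w - η * ((j : ℝ) - J)| ≤ η := by
  have hw' := abs_le.1 hw
  have h1 : W / η * η = W := by field_simp
  have h2 : w / η * η = w := by field_simp
  have hlo : -(J : ℝ) ≤ w / η := by
    have : -(W / η) ≤ w / η := by rw [← neg_div]; gcongr; linarith
    linarith
  have hhi : w / η ≤ J - 1 := by
    have : w / η ≤ W / η := by gcongr; linarith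
    linarith
  have hf : 0 ≤ w / η + J := by linarith
  have hlt : ⌊w / η + J⌋₊ < 2 * J + 1 := by
    rw [Nat.floor_lt hf]; push_cast; linarith
  refine ⟨⟨⌊w / η + J⌋₊, hlt⟩, ?_⟩
  have h3 := Nat.floor_le hf
  have h4 := Nat.lt_floor_add_one (w / η + J)
  simp only
  rw [abs_le]
  constructor
  · have := mul_le_mul_of_nonneg_right h3 hη.le
    nlinarith
  · have := mul_le_mul_of_nonneg_right h4.le hη.le
    nlinarith

lemma measurable_logSumExpFeatures {E ι : Type*} [MeasurableSpace E] [Fintype ι] {k : ℕ}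
    {φ : ι → E → ℝ} (hφ : ∀ s, Measurable (φ s)) (w : Fin k → ι → ℝ) :
    Measurable (logSumExpFeatures φ w) := by
  unfold logSumExpFeatures
  fun_prop

lemma abs_clip_le {b a : ℝ} (hb : 0 ≤ b) : |max (-b) (min b a)| ≤ b :=
  abs_le.2 ⟨le_max_left _ _, max_le (by linarith) (min_le_left _ _)⟩

/-- Clipping to `[-b, b]` is 1-Lipschitz and fixes `f`. -/
lemma abs_sub_clip_le {b a f : ℝ} (hf : |f| ≤ b) : |f - max (-b) (min b a)| ≤ |f - a| := by
  have h := abs_le.1 hf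
  have h1 : max (-b) (min b f) = f := by rw [min_eq_right h.2, max_eq_right h.1]
  calc |f - max (-b) (min b a)| = |max (-b) (min b f) - max (-b) (min b a)| := by rw [h1]
    _ ≤ |min b f - min b a| := by
      simpa using abs_max_sub_max_le_max (-b) (min b f) (-b) (min b a)
    _ ≤ |f - a| := by
      simpa using abs_min_sub_min_le_max b f b a

/-- Uniform deviation over all functions which, on a set `B` containing the sample, are bounded and
uniformly approximated by log-sum-exps of linear combinations of bounded features. -/
lemma exists_measurableSet_logSumExpFeatures_deviation {E : Type*} [MeasurableSpace E]
    (ρ : Measure E) [IsProbabilityMeasure ρ] {m : ℕ} (hm : 0 < m) {ι : Type*} [Fintype ι]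
    {k : ℕ} (hk : 0 < k) {φ : ι → E → ℝ} (hφ : ∀ s, Measurable (φ s)) {B : Set E}
    (hB : MeasurableSet B) {Φ : ℝ} (hΦ : ∀ x ∈ B, ∀ s, |φ s x| ≤ Φ) {b W η δ L ε : ℝ}
    (hb : 0 < b) (hη : 0 < η) {J : ℕ} (hJ : W / η + 1 ≤ J) (hL : 0 ≤ L)
    (hcard : 2 * (2 * (J : ℝ) + 1) ^ (k * Fintype.card ι) ≤ δ * Real.exp L)
    (hε : 0 ≤ ε + Fintype.card ι * (η * Φ)) :
    ∃ G : Set (Fin m → E), MeasurableSet G ∧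
      (Measure.pi fun _ : Fin m => ρ) Gᶜ ≤ ENNReal.ofReal δ ∧
      ∀ x ∈ G, (∀ j, x j ∈ B) → ∀ f : E → ℝ, Measurable f → (∀ y ∈ B, |f y| ≤ b) →
        (∃ w : Fin k → ι → ℝ, (∀ i s, |w i s| ≤ W) ∧
          ∀ y ∈ B, |f y - logSumExpFeatures φ w y| ≤ ε) →
        |∫ y in B, f y ∂ρ - (m : ℝ)⁻¹ * ∑ j, f (x j)| ≤
          b * Real.sqrt (2 * L / m) + 2 * (ε + Fintype.card ι * (η * Φ)) := by
  classical
  have hm' : (0 : ℝ) < m := by exact_mod_cast hm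
  let v : (Fin k → ι → Fin (2 * J + 1)) → Fin k → ι → ℝ := fun q i s => η * ((q i s : ℝ) - J)
  -- Clipping and restriction to `B` make every grid function bounded by `b` on the whole space, as
  -- Hoeffding requires, without moving it away from a target bounded by `b` on `B`.
  let g : (Fin k → ι → Fin (2 * J + 1)) → E → ℝ := fun q =>
    B.indicator fun y => max (-b) (min b (logSumExpFeatures φ (v q) y))
  have hg : ∀ q, Measurable (g q) := fun q =>
    Measurable.indicator (measurable_const.max (measurable_const.min
      (measurable_logSumExpFeatures hφ _))) hB
  have hgb : ∀ q y, |g q y| ≤ b := by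
    intro q y
    by_cases hy : y ∈ B
    · simpa only [g, Set.indicator_of_mem hy] using abs_clip_le hb.le
    · simpa only [g, Set.indicator_of_notMem hy, abs_zero] using hb.le
  obtain ⟨G, hG, hGδ, hdev⟩ := exists_measurableSet_finite_class_deviation ρ hm hg hb hgb hL
    (by
      refine le_trans (le_of_eq ?_) hcard
      simp only [Fintype.card_fun, Fintype.card_fin, Nat.cast_pow, ← pow_mul]
      push_cast
      rw [mul_comm k])
  refine ⟨G, hG, hGδ, fun x hx hxB f hf hfb ⟨w, hw, hfw⟩ => ?_⟩
  choose q hq using fun i s => exists_grid_approx hη hJ (hw i s)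
  set e := ε + Fintype.card ι * (η * Φ) with he
  have hclose : ∀ y ∈ B, |f y - g q y| ≤ e := by
    intro y hy
    simp only [g, Set.indicator_of_mem hy]
    refine (abs_sub_clip_le (hfb y hy)).trans ?_
    have h1 := hfw y hy
    have h2 := abs_logSumExpFeatures_sub_le hk φ hη.le (w' := v q) hq (hΦ y hy)
    calc _ ≤ _ := abs_sub_le _ (logSumExpFeatures φ w y) _
      _ ≤ _ := add_le_add h1 h2
  have hint : ∀ h : E → ℝ, Measurable h → (∀ y, |h y| ≤ b) → Integrable h ρ := fun h hh hhb =>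
    Integrable.of_bound hh.aestronglyMeasurable b (Filter.Eventually.of_forall hhb)
  have h1 : |∫ y in B, f y ∂ρ - ∫ y, g q y ∂ρ| ≤ e := by
    rw [← integral_indicator hB, ← integral_sub (hint _ (hf.indicator hB) fun y => by
      by_cases hy : y ∈ B
      · simpa only [Set.indicator_of_mem hy] using hfb y hy
      · simpa only [Set.indicator_of_notMem hy, abs_zero] using hb.le) (hint _ (hg q) (hgb q))]
    have := norm_integral_le_of_norm_le_const (μ := ρ) (C := e)
      (f := fun y => B.indicator f y - g q y) (Filter.Eventually.of_forall fun y => by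
        by_cases hy : y ∈ B
        · simpa only [Set.indicator_of_mem hy, Real.norm_eq_abs] using hclose y hy
        · simpa only [g, Set.indicator_of_notMem hy, sub_self, norm_zero] using hε)
    simpa using this
  have h2 : |(m : ℝ)⁻¹ * ∑ j, g q (x j) - (m : ℝ)⁻¹ * ∑ j, f (x j)| ≤ e := by
    rw [← mul_sub, ← Finset.sum_sub_distrib, abs_mul, abs_of_pos (inv_pos.2 hm'),
      inv_mul_le_iff₀ hm']
    refine (Finset.abs_sum_le_sum_abs _ _).trans ?_
    refine (Finset.sum_le_card_nsmul _ _ e fun j _ => ?_).trans_eq (by simp)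
    rw [abs_sub_comm]
    exact hclose _ (hxB j)
  have h3 := hdev x hx q
  rw [abs_le] at *
  constructor <;> linarith [h1.1, h1.2, h2.1, h2.2, h3.1, h3.2]

end LogSumExp

/-! ### Growth of mixture scores -/

section ScoreBounds

variable {d : ℕ}

/-- The logarithm of the normalizing constant of the Gaussian density with covariance `S`. -/
def gaussianLogNormalizer (S : Matrix (Fin d) (Fin d) ℝ) : ℝ :=
  -(1 / 2) * Real.log ((2 * Real.pi) ^ d * S.det)

lemma gaussianDensity_eq_exp {S : Matrix (Fin d) (Fin d) ℝ} (hS : 0 < S.det)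
    (μ x : EuclideanSpace ℝ (Fin d)) :
    gaussianDensity μ S x = Real.exp (gaussianLogNormalizer S -
      1 / 2 * ((x - μ).ofLp ⬝ᵥ S⁻¹.mulVec (x - μ).ofLp)) := by
  have h : 0 < (2 * Real.pi) ^ d * S.det := by positivity
  have hz : Real.exp (gaussianLogNormalizer S) = 1 / Real.sqrt ((2 * Real.pi) ^ d * S.det) := by
    rw [gaussianLogNormalizer, neg_mul, Real.exp_neg,
      show 1 / 2 * Real.log ((2 * Real.pi) ^ d * S.det) =
        Real.log (Real.sqrt ((2 * Real.pi) ^ d * S.det)) by rw [Real.log_sqrt h.le]; ring,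
      Real.exp_log (Real.sqrt_pos.2 h), one_div]
  rw [gaussianDensity, ← hz, ← Real.exp_add, neg_mul, ← sub_eq_add_neg]

/-- The inequality `log t ≤ t - 1` at `t = 1 / σ₁` trades the logarithm for a polynomial bound. -/
lemma gaussianLogNormalizer_le {S : Matrix (Fin d) (Fin d) ℝ} {σ₁ : ℝ} (hσ : 0 < σ₁)
    (h : (S - σ₁ • (1 : Matrix (Fin d) (Fin d) ℝ)).PosSemidef) :
    gaussianLogNormalizer S ≤ d / 2 * (1 / σ₁) := by
  have hdet := pow_le_det_of_posSemidef_sub hσ h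
  have hpow : 0 < σ₁ ^ d := by positivity
  have h1 := Real.log_le_log hpow hdet
  rw [Real.log_pow] at h1
  have h2 : -(1 / σ₁) ≤ Real.log σ₁ := by
    have := Real.log_le_sub_one_of_pos (inv_pos.2 hσ)
    rw [Real.log_inv] at this
    rw [one_div]; linarith
  have h3 : 0 ≤ Real.log (2 * Real.pi) := Real.log_nonneg (by linarith [Real.pi_gt_three])
  have hd : (0 : ℝ) ≤ d := Nat.cast_nonneg d
  rw [gaussianLogNormalizer, Real.log_mul (by positivity) (hpow.trans_le hdet).ne', Real.log_pow]
  nlinarith [mul_nonneg hd h3, mul_le_mul_of_nonneg_left h2 hd]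

lemma le_gaussianLogNormalizer {S : Matrix (Fin d) (Fin d) ℝ} {σ₁ σ₂ : ℝ} (hσ : 0 < σ₁)
    (hσ₂ : 0 < σ₂) (h : (S - σ₁ • (1 : Matrix (Fin d) (Fin d) ℝ)).PosSemidef)
    (h' : (σ₂ • (1 : Matrix (Fin d) (Fin d) ℝ) - S).PosSemidef) :
    -(d / 2 * (6 + σ₂)) ≤ gaussianLogNormalizer S := by
  have hdet := pow_le_det_of_posSemidef_sub hσ h
  have hdet' := det_le_pow_of_posSemidef_sub hσ h h'
  have hpow : 0 < σ₁ ^ d := by positivity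
  have h1 := Real.log_le_log (hpow.trans_le hdet) hdet'
  rw [Real.log_pow] at h1
  have h2 := Real.log_le_sub_one_of_pos hσ₂
  have h3 := Real.log_le_sub_one_of_pos (show 0 < 2 * Real.pi by positivity)
  have h4 := Real.pi_lt_d2
  have hd : (0 : ℝ) ≤ d := Nat.cast_nonneg d
  rw [gaussianLogNormalizer, Real.log_mul (by positivity) (hpow.trans_le hdet).ne', Real.log_pow]
  have h5 : Real.log (2 * Real.pi) + Real.log σ₂ ≤ 6 + σ₂ := by linarith
  nlinarith [mul_le_mul_of_nonneg_left h5 hd]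

/-- The mixture has weights in the simplex, and its size, its log-normalizers, and its precision
matrices are controlled by `Q`. -/
structure MixtureParams.IsControlled (θ : MixtureParams d) (Q : ℝ) : Prop where
  one_le : 1 ≤ Q
  dim_le : (d : ℝ) ≤ Q
  size_le : (θ.size : ℝ) ≤ Q
  weight_nonneg : ∀ i, 0 ≤ θ.weight i
  sum_weight : ∑ i, θ.weight i = 1
  density_eq : ∀ i x, gaussianDensity (θ.mean i) (θ.cov i) x =
    Real.exp (gaussianLogNormalizer (θ.cov i) -
      1 / 2 * ((x - θ.mean i).ofLp ⬝ᵥ (θ.cov i)⁻¹.mulVec (x - θ.mean i).ofLp))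
  logNormalizer_le : ∀ i, gaussianLogNormalizer (θ.cov i) ≤ Q ^ 2
  le_logNormalizer : ∀ i, -(4 * Q ^ 2) ≤ gaussianLogNormalizer (θ.cov i)
  quad_le : ∀ i (v : EuclideanSpace ℝ (Fin d)),
    v.ofLp ⬝ᵥ (θ.cov i)⁻¹.mulVec v.ofLp ≤ Q * ‖v‖ ^ 2
  le_quad : ∀ i (v : EuclideanSpace ℝ (Fin d)),
    ‖v‖ ^ 2 ≤ Q * (v.ofLp ⬝ᵥ (θ.cov i)⁻¹.mulVec v.ofLp)
  abs_inv_le : ∀ i a b, |(θ.cov i)⁻¹ a b| ≤ Q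

lemma dotProduct_ofLp_self (v : EuclideanSpace ℝ (Fin d)) : v.ofLp ⬝ᵥ v.ofLp = ‖v‖ ^ 2 := by
  rw [EuclideanSpace.real_norm_sq_eq]
  simp only [dotProduct, ← pow_two]

lemma MixtureParams.isControlled_of_mem_mogClass {θ : MixtureParams d}
    {ν : Measure (EuclideanSpace ℝ (Fin d))} {c σ₁ σ₂ Q : ℝ} {k : ℕ}
    (hθ : θ ∈ mogClass ν c k σ₁ σ₂) (hσ₁ : 0 < σ₁) (hσ₂ : 0 < σ₂) (hQ : 1 ≤ Q)
    (hd : (d : ℝ) ≤ Q) (hk : (k : ℝ) ≤ Q) (hσ₂Q : σ₂ ≤ Q) (hσ₁Q : 1 / σ₁ ≤ Q) :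
    θ.IsControlled Q := by
  obtain ⟨hsize, hw, hsum, hcov, -, -⟩ := hθ
  have hd0 : (0 : ℝ) ≤ d := Nat.cast_nonneg d
  refine ⟨hQ, hd, le_trans (by exact_mod_cast hsize) hk, hw, hsum, fun i x => ?_, fun i => ?_,
    fun i => ?_, fun i v => ?_, fun i v => ?_, fun i a b => ?_⟩
  · exact gaussianDensity_eq_exp (posDef_of_posSemidef_sub hσ₁ (hcov i).1).det_pos _ _
  · refine (gaussianLogNormalizer_le hσ₁ (hcov i).1).trans ?_
    have : 0 < 1 / σ₁ := by positivity
    nlinarith [mul_le_mul hd hσ₁Q this.le (by linarith)]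
  · refine le_trans ?_ (le_gaussianLogNormalizer hσ₁ hσ₂ (hcov i).1 (hcov i).2)
    nlinarith [mul_le_mul hd hσ₂Q hσ₂.le (by linarith)]
  · refine (dotProduct_inv_mulVec_le hσ₁ (hcov i).1 _).trans ?_
    rw [dotProduct_ofLp_self, div_eq_mul_one_div, mul_comm]
    gcongr
  · have h := le_dotProduct_inv_mulVec hσ₁ hσ₂ (hcov i).1 (hcov i).2 v.ofLp
    rw [dotProduct_ofLp_self, div_le_iff₀ hσ₂, mul_comm] at h
    refine h.trans ?_
    have := dotProduct_inv_mulVec_nonneg (posDef_of_posSemidef_sub hσ₁ (hcov i).1) v.ofLp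
    gcongr
  · exact (abs_inv_apply_le hσ₁ (hcov i).1 a b).trans hσ₁Q

lemma continuous_gaussianDensity (μ : EuclideanSpace ℝ (Fin d)) (S : Matrix (Fin d) (Fin d) ℝ) :
    Continuous (gaussianDensity μ S) := by
  unfold gaussianDensity
  simp only [dotProduct, Matrix.mulVec]
  fun_prop

lemma measurable_mixtureScore (θ : MixtureParams d) : Measurable (mixtureScore θ) := by
  unfold mixtureScore
  exact Real.measurable_log.comp (Continuous.measurable (continuous_finsetSum _ fun i _ =>
    (continuous_gaussianDensity _ _).const_mul _))

namespace MixtureParams.IsControlled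

variable {θ : MixtureParams d} {Q : ℝ}

lemma quad_nonneg (h : θ.IsControlled Q) (i : Fin θ.size) (v : EuclideanSpace ℝ (Fin d)) :
    0 ≤ v.ofLp ⬝ᵥ (θ.cov i)⁻¹.mulVec v.ofLp := by
  have h1 := h.le_quad i v
  have h2 := h.one_le
  by_contra! hneg
  nlinarith [sq_nonneg ‖v‖]

lemma weight_le_one (h : θ.IsControlled Q) (i : Fin θ.size) : θ.weight i ≤ 1 := by
  rw [← h.sum_weight]
  exact Finset.single_le_sum (fun j _ => h.weight_nonneg j) (Finset.mem_univ i)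

lemma density_pos (h : θ.IsControlled Q) (i : Fin θ.size) (x : EuclideanSpace ℝ (Fin d)) :
    0 < gaussianDensity (θ.mean i) (θ.cov i) x := by
  rw [h.density_eq]; exact Real.exp_pos _

lemma density_le (h : θ.IsControlled Q) (i : Fin θ.size) (x : EuclideanSpace ℝ (Fin d)) :
    gaussianDensity (θ.mean i) (θ.cov i) x ≤ Real.exp (Q ^ 2) := by
  rw [h.density_eq]
  have := h.quad_nonneg i (x - θ.mean i)
  have := h.logNormalizer_le i
  exact Real.exp_le_exp.2 (by linarith)

lemma term_nonneg (h : θ.IsControlled Q) (i : Fin θ.size) (x : EuclideanSpace ℝ (Fin d)) :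
    0 ≤ θ.weight i * gaussianDensity (θ.mean i) (θ.cov i) x :=
  mul_nonneg (h.weight_nonneg i) (h.density_pos i x).le

lemma mixture_pos (h : θ.IsControlled Q) (x : EuclideanSpace ℝ (Fin d)) :
    0 < ∑ i, θ.weight i * gaussianDensity (θ.mean i) (θ.cov i) x := by
  obtain ⟨i, hi, hne⟩ : ∃ i ∈ Finset.univ, θ.weight i ≠ 0 :=
    Finset.exists_ne_zero_of_sum_ne_zero (by rw [h.sum_weight]; exact one_ne_zero)
  exact Finset.sum_pos' (fun j _ => h.term_nonneg j x)
    ⟨i, hi, mul_pos (lt_of_le_of_ne (h.weight_nonneg i) hne.symm) (h.density_pos i x)⟩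

lemma score_le (h : θ.IsControlled Q) (x : EuclideanSpace ℝ (Fin d)) :
    mixtureScore θ x ≤ Q ^ 2 := by
  rw [mixtureScore, Real.log_le_iff_le_exp (h.mixture_pos x)]
  calc _ ≤ ∑ i, θ.weight i * Real.exp (Q ^ 2) := Finset.sum_le_sum fun i _ =>
        mul_le_mul_of_nonneg_left (h.density_le i x) (h.weight_nonneg i)
    _ = Real.exp (Q ^ 2) := by rw [← Finset.sum_mul, h.sum_weight, one_mul]

lemma exp_le_mixture (h : θ.IsControlled Q) {x : EuclideanSpace ℝ (Fin d)} {s : ℝ}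
    (hs : s ≤ mixtureScore θ x) :
    Real.exp s ≤ ∑ i, θ.weight i * gaussianDensity (θ.mean i) (θ.cov i) x :=
  (Real.le_log_iff_exp_le (h.mixture_pos x)).1 hs

/-- Pigeonhole: there are at most `Q ≤ exp (Q ^ 2)` terms, so they cannot all be below `exp (s - Q ^
2)`. -/
lemma exists_exp_le_term (h : θ.IsControlled Q) {x : EuclideanSpace ℝ (Fin d)} {s : ℝ}
    (hs : s ≤ mixtureScore θ x) :
    ∃ i, Real.exp (s - Q ^ 2) ≤ θ.weight i * gaussianDensity (θ.mean i) (θ.cov i) x := by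
  by_contra! hlt
  have hne : (Finset.univ : Finset (Fin θ.size)).Nonempty := by
    by_contra hemp
    have := h.sum_weight
    rw [Finset.not_nonempty_iff_eq_empty.1 hemp] at this
    simp at this
  have h1 := Finset.sum_lt_sum_of_nonempty hne fun i _ => hlt i
  have h2 := h.exp_le_mixture hs
  have h3 : (θ.size : ℝ) ≤ Real.exp (Q ^ 2) := by
    have := Real.add_one_le_exp (Q ^ 2)
    nlinarith [h.size_le, h.one_le]
  have h4 : (θ.size : ℝ) * Real.exp (s - Q ^ 2) ≤ Real.exp s := by
    calc _ ≤ Real.exp (Q ^ 2) * Real.exp (s - Q ^ 2) := by gcongr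
      _ = Real.exp s := by rw [← Real.exp_add]; congr 1; ring
  simp only [Finset.sum_const, Finset.card_univ, Fintype.card_fin, nsmul_eq_mul] at h1
  linarith

/-- A term which is not too small at `x` has a weight bounded below and a mean near `x`. -/
lemma bounds_of_exp_le_term (h : θ.IsControlled Q) {x : EuclideanSpace ℝ (Fin d)} {T : ℝ}
    {i : Fin θ.size}
    (hi : Real.exp (-T) ≤ θ.weight i * gaussianDensity (θ.mean i) (θ.cov i) x) :
    0 < θ.weight i ∧ -(T + Q ^ 2) ≤ Real.log (θ.weight i) ∧
      ‖x - θ.mean i‖ ^ 2 ≤ 2 * Q * (T + Q ^ 2) := by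
  have hQ := h.one_le
  have hpos : 0 < θ.weight i := by
    refine lt_of_le_of_ne (h.weight_nonneg i) fun h0 => ?_
    rw [← h0, zero_mul] at hi
    exact absurd (Real.exp_pos (-T)) (not_lt.2 hi)
  have hlog := Real.log_le_log (Real.exp_pos _) hi
  rw [Real.log_exp, Real.log_mul hpos.ne' (h.density_pos i x).ne', h.density_eq,
    Real.log_exp] at hlog
  have h1 := h.quad_nonneg i (x - θ.mean i)
  have h2 := h.logNormalizer_le i
  have h3 : Real.log (θ.weight i) ≤ 0 := Real.log_nonpos hpos.le (h.weight_le_one i)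
  refine ⟨hpos, by linarith, (h.le_quad i _).trans ?_⟩
  rw [mul_comm 2 Q, mul_assoc]
  exact mul_le_mul_of_nonneg_left (by linarith) (by linarith)

/-- If the expected score is not too small, the score is not too small at some point of any set
carrying half of the mass. -/
lemma exists_mem_le_score (h : θ.IsControlled Q) {ν : Measure (EuclideanSpace ℝ (Fin d))}
    [IsProbabilityMeasure ν] {B : Set (EuclideanSpace ℝ (Fin d))} (hB : MeasurableSet B)
    (hνB : 1 / 2 ≤ ν.real B) {c : ℝ} (hcQ : |c| ≤ Q) (hint : Integrable (mixtureScore θ) ν)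
    (hc : c ≤ ∫ x, mixtureScore θ x ∂ν) : ∃ x ∈ B, -(5 * Q ^ 2) ≤ mixtureScore θ x := by
  by_contra! hlt
  have hQ := h.one_le
  -- This majorant is `-5 * Q ^ 2` on `B` and `Q ^ 2` off `B`; its integral is at most `-2 * Q ^ 2 <
  -- -Q ≤ c`.
  have hint' : Integrable (fun x => Q ^ 2 + B.indicator (fun _ => -(6 * Q ^ 2)) x) ν :=
    (integrable_const _).add ((integrable_const _).indicator hB)
  have h1 : ∫ x, mixtureScore θ x ∂ν ≤ ∫ x, (Q ^ 2 + B.indicator (fun _ => -(6 * Q ^ 2)) x) ∂ν := by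
    refine integral_mono hint hint' fun x => ?_
    by_cases hx : x ∈ B
    · simp only [Set.indicator_of_mem hx]; linarith [hlt x hx]
    · simp only [Set.indicator_of_notMem hx]; linarith [h.score_le x]
  rw [integral_add (integrable_const _) ((integrable_const _).indicator hB),
    integral_indicator_const _ hB] at h1
  simp only [integral_const, probReal_univ, smul_eq_mul, one_mul] at h1
  have := neg_abs_le c
  nlinarith

/-- A controlled mixture whose score is not too small near `x₀` has a score of quadratic growth. -/
lemma abs_score_le (h : θ.IsControlled Q) {x₀ z : EuclideanSpace ℝ (Fin d)}
    (hz : ‖z - x₀‖ ≤ 4 * Q) (hs : -(5 * Q ^ 2) ≤ mixtureScore θ z)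
    (x : EuclideanSpace ℝ (Fin d)) :
    |mixtureScore θ x| ≤ 100 * Q ^ 4 * (1 + ‖x - x₀‖ ^ 2) := by
  have hQ := h.one_le
  obtain ⟨i, hi⟩ := h.exists_exp_le_term hs
  rw [show -(5 * Q ^ 2) - Q ^ 2 = -(6 * Q ^ 2) by ring] at hi
  -- Here `T = 6 * Q ^ 2`: the log-weight is at least `-7 * Q ^ 2` and the squared distance from `z`
  -- to the mean is at most `14 * Q ^ 3`.
  obtain ⟨hpos, hlog, hmean⟩ := h.bounds_of_exp_le_term hi
  have hx1 : ‖x - θ.mean i‖ ≤ ‖x - x₀‖ + (‖z - x₀‖ + ‖z - θ.mean i‖) := by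
    calc _ = ‖(x - x₀) - (z - x₀) + (z - θ.mean i)‖ := by congr 1; abel
      _ ≤ ‖(x - x₀) - (z - x₀)‖ + ‖z - θ.mean i‖ := norm_add_le _ _
      _ ≤ _ := by linarith [norm_sub_le (x - x₀) (z - x₀)]
  have hx2 : ‖x - θ.mean i‖ ^ 2 ≤ 2 * ‖x - x₀‖ ^ 2 + 4 * ‖z - x₀‖ ^ 2 + 4 * ‖z - θ.mean i‖ ^ 2 := by
    have := pow_le_pow_left₀ (norm_nonneg _) hx1 2
    nlinarith [sq_nonneg (‖x - x₀‖ - (‖z - x₀‖ + ‖z - θ.mean i‖)),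
      sq_nonneg (‖z - x₀‖ - ‖z - θ.mean i‖)]
  have hz2 : ‖z - x₀‖ ^ 2 ≤ 16 * Q ^ 2 := by
    have := pow_le_pow_left₀ (norm_nonneg _) hz 2
    linarith
  -- The mixture dominates this single term, whose logarithm is quadratic.
  have hlow : Real.log (θ.weight i) + (gaussianLogNormalizer (θ.cov i) -
      1 / 2 * ((x - θ.mean i).ofLp ⬝ᵥ (θ.cov i)⁻¹.mulVec (x - θ.mean i).ofLp)) ≤
        mixtureScore θ x := by
    rw [mixtureScore, Real.le_log_iff_exp_le (h.mixture_pos x), Real.exp_add, Real.exp_log hpos,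
      ← h.density_eq]
    exact Finset.single_le_sum (f := fun i => θ.weight i * gaussianDensity (θ.mean i) (θ.cov i) x)
      (fun j _ => h.term_nonneg j x) (Finset.mem_univ i)
  have hq := h.quad_le i (x - θ.mean i)
  have hn := h.le_logNormalizer i
  have hu := h.score_le x
  have hq' : Q * ‖x - θ.mean i‖ ^ 2 ≤
      Q * (2 * ‖x - x₀‖ ^ 2 + 4 * (16 * Q ^ 2) + 4 * (2 * Q * (6 * Q ^ 2 + Q ^ 2))) :=
    mul_le_mul_of_nonneg_left (by linarith) (by linarith)
  have e1 : Q ^ 2 ≤ Q ^ 4 := pow_le_pow_right₀ hQ (by norm_num)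
  have e2 : Q ^ 3 ≤ Q ^ 4 := pow_le_pow_right₀ hQ (by norm_num)
  have e3 : Q ≤ Q ^ 4 := le_self_pow₀ hQ (by norm_num)
  have e4 : 0 ≤ ‖x - x₀‖ ^ 2 := sq_nonneg _
  have e5 : Q * ‖x - x₀‖ ^ 2 ≤ Q ^ 4 * ‖x - x₀‖ ^ 2 := mul_le_mul_of_nonneg_right e3 e4
  have e6 : 0 ≤ Q ^ 4 * ‖x - x₀‖ ^ 2 := by positivity
  rw [abs_le]
  constructor
  · nlinarith
  · nlinarith

end MixtureParams.IsControlled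

end ScoreBounds

/-! ### Approximation of scores by log-sum-exps of quadratic polynomials -/

section QuadraticFeatures

variable {d : ℕ}

/-- The monomials of degree at most two in the coordinates of `x - x₀`. -/
def quadraticFeature (x₀ : EuclideanSpace ℝ (Fin d)) :
    Option (Fin d ⊕ Fin d × Fin d) → EuclideanSpace ℝ (Fin d) → ℝ
  | none, _ => 1
  | some (Sum.inl a), x => (x - x₀) a
  | some (Sum.inr (a, b)), x => (x - x₀) a * (x - x₀) b

/-- The coefficients of `r - (x - μ) ⬝ P (x - μ) / 2` in the monomials of `x - x₀`, with
`u = μ - x₀`. -/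
def quadraticCoeff (r : ℝ) (P : Matrix (Fin d) (Fin d) ℝ) (u : Fin d → ℝ) :
    Option (Fin d ⊕ Fin d × Fin d) → ℝ
  | none => r - 1 / 2 * (u ⬝ᵥ P.mulVec u)
  | some (Sum.inl a) => 1 / 2 * (P.mulVec u a + Matrix.vecMul u P a)
  | some (Sum.inr (a, b)) => -(1 / 2) * P a b

lemma measurable_quadraticFeature (x₀ : EuclideanSpace ℝ (Fin d))
    (s : Option (Fin d ⊕ Fin d × Fin d)) : Measurable (quadraticFeature x₀ s) := by
  apply Continuous.measurable
  rcases s with _ | a | ⟨a, b⟩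
  · exact continuous_const
  · change Continuous fun x : EuclideanSpace ℝ (Fin d) => (x - x₀) a
    fun_prop
  · change Continuous fun x : EuclideanSpace ℝ (Fin d) => (x - x₀) a * (x - x₀) b
    fun_prop

lemma abs_apply_le_norm (v : EuclideanSpace ℝ (Fin d)) (a : Fin d) : |v a| ≤ ‖v‖ := by
  simpa using PiLp.norm_apply_le v a

lemma abs_quadraticFeature_le {x₀ x : EuclideanSpace ℝ (Fin d)} {R : ℝ} (hR : 1 ≤ R)
    (hx : ‖x - x₀‖ ≤ R) (s : Option (Fin d ⊕ Fin d × Fin d)) :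
    |quadraticFeature x₀ s x| ≤ R ^ 2 := by
  have h (a : Fin d) : |(x - x₀) a| ≤ R := (abs_apply_le_norm _ a).trans hx
  rcases s with _ | a | ⟨a, b⟩ <;> simp only [quadraticFeature]
  · rw [abs_one]; nlinarith
  · have := h a; nlinarith
  · rw [abs_mul, pow_two]
    exact mul_le_mul (h a) (h b) (abs_nonneg _) (by linarith)

lemma card_quadraticFeature :
    Fintype.card (Option (Fin d ⊕ Fin d × Fin d)) = d + d * d + 1 := by
  simp

lemma sum_quadraticCoeff_mul (r : ℝ) (P : Matrix (Fin d) (Fin d) ℝ)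
    (x₀ μ x : EuclideanSpace ℝ (Fin d)) :
    ∑ s, quadraticCoeff r P (μ - x₀).ofLp s * quadraticFeature x₀ s x =
      r - 1 / 2 * ((x - μ).ofLp ⬝ᵥ P.mulVec (x - μ).ofLp) := by
  set u := (μ - x₀).ofLp with hu
  set y := (x - x₀).ofLp with hy
  have hxμ : (x - μ).ofLp = y - u := by
    rw [hu, hy, show x - μ = (x - x₀) - (μ - x₀) by abel, WithLp.ofLp_sub]
  have h1 : u ⬝ᵥ P.mulVec y = ∑ a, Matrix.vecMul u P a * y a := by
    rw [Matrix.dotProduct_mulVec]; rfl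
  have h2 : y ⬝ᵥ P.mulVec u = ∑ a, P.mulVec u a * y a := by
    rw [dotProduct_comm]; rfl
  have h3 : y ⬝ᵥ P.mulVec y = ∑ a, ∑ b, P a b * (y a * y b) := by
    simp only [dotProduct, Matrix.mulVec, Finset.mul_sum]
    exact Finset.sum_congr rfl fun a _ => Finset.sum_congr rfl fun b _ => by ring
  rw [hxμ, Matrix.mulVec_sub, sub_dotProduct, dotProduct_sub, dotProduct_sub, h1, h2, h3]
  simp only [Fintype.sum_option, Fintype.sum_sum_type, Fintype.sum_prod_type, quadraticCoeff,
    quadraticFeature]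
  change (r - 1 / 2 * u ⬝ᵥ P.mulVec u) * 1 +
    (∑ a, 1 / 2 * (P.mulVec u a + Matrix.vecMul u P a) * y a +
      ∑ a, ∑ b, -(1 / 2) * P a b * (y a * y b)) = _
  have h4 : ∑ a, 1 / 2 * (P.mulVec u a + Matrix.vecMul u P a) * y a =
      1 / 2 * (∑ a, P.mulVec u a * y a + ∑ a, Matrix.vecMul u P a * y a) := by
    rw [← Finset.sum_add_distrib, Finset.mul_sum]
    exact Finset.sum_congr rfl fun a _ => by ring
  have h5 : ∑ a, ∑ b, -(1 / 2) * P a b * (y a * y b) =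
      -(1 / 2) * ∑ a, ∑ b, P a b * (y a * y b) := by
    simp only [Finset.mul_sum, mul_assoc]
  rw [h4, h5]
  ring

lemma sum_quadraticCoeff_zero_mul (r : ℝ) (x₀ x : EuclideanSpace ℝ (Fin d)) :
    ∑ s, quadraticCoeff r (0 : Matrix (Fin d) (Fin d) ℝ) 0 s * quadraticFeature x₀ s x = r := by
  simp [Fintype.sum_option, quadraticCoeff, quadraticFeature]

lemma abs_quadraticCoeff_zero_le (r : ℝ) (s : Option (Fin d ⊕ Fin d × Fin d)) :
    |quadraticCoeff r (0 : Matrix (Fin d) (Fin d) ℝ) 0 s| ≤ |r| := by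
  rcases s with _ | a | ⟨a, b⟩ <;> simp [quadraticCoeff]

lemma abs_quadraticCoeff_le {r A Q V : ℝ} {P : Matrix (Fin d) (Fin d) ℝ}
    {u : EuclideanSpace ℝ (Fin d)} (hQ : 1 ≤ Q) (hd : (d : ℝ) ≤ Q) (hr : |r| ≤ A)
    (hP : ∀ a b, |P a b| ≤ Q) (hquad : |u.ofLp ⬝ᵥ P.mulVec u.ofLp| ≤ Q * ‖u‖ ^ 2)
    (hu : ‖u‖ ≤ V) (hV : 1 ≤ V) (s : Option (Fin d ⊕ Fin d × Fin d)) :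
    |quadraticCoeff r P u.ofLp s| ≤ A + Q ^ 2 * V ^ 2 := by
  have hA : 0 ≤ A := (abs_nonneg r).trans hr
  have hsum (f : Fin d → ℝ) (hf : ∀ b, |f b| ≤ Q) : ∑ b, |f b| * |u b| ≤ Q ^ 2 * V := by
    calc _ ≤ ∑ _b : Fin d, Q * V := Finset.sum_le_sum fun b _ =>
          mul_le_mul (hf b) ((abs_apply_le_norm u b).trans hu) (abs_nonneg _) (by linarith)
      _ = d * (Q * V) := by simp
      _ ≤ Q * (Q * V) := mul_le_mul_of_nonneg_right hd (by positivity)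
      _ = _ := by ring
  have hV2 : V ≤ V ^ 2 := by nlinarith
  have hQV : Q ^ 2 * V ≤ Q ^ 2 * V ^ 2 := mul_le_mul_of_nonneg_left hV2 (sq_nonneg _)
  have hQ2 : Q ≤ Q ^ 2 := by nlinarith
  rcases s with _ | a | ⟨a, b⟩ <;> simp only [quadraticCoeff]
  · have h1 : Q * ‖u‖ ^ 2 ≤ Q ^ 2 * V ^ 2 :=
      mul_le_mul hQ2 (pow_le_pow_left₀ (norm_nonneg _) hu 2) (sq_nonneg _) (sq_nonneg _)
    have := abs_le.1 hr
    have := abs_le.1 hquad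
    have : 0 ≤ Q ^ 2 * V ^ 2 := by positivity
    rw [abs_le]; constructor <;> linarith
  · have h1 : |P.mulVec u.ofLp a| ≤ Q ^ 2 * V := by
      simp only [Matrix.mulVec, dotProduct]
      refine (Finset.abs_sum_le_sum_abs _ _).trans ?_
      simp only [abs_mul]
      exact hsum _ fun b => hP a b
    have h2 : |Matrix.vecMul u.ofLp P a| ≤ Q ^ 2 * V := by
      simp only [Matrix.vecMul, dotProduct]
      refine (Finset.abs_sum_le_sum_abs _ _).trans ?_
      simp only [abs_mul, mul_comm |u.ofLp _|]
      exact hsum _ fun b => hP b a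
    rw [abs_le] at *
    constructor <;> linarith [h1.1, h1.2, h2.1, h2.2]
  · have := abs_le.1 (hP a b)
    have : Q ^ 2 * 1 ≤ Q ^ 2 * V ^ 2 := mul_le_mul_of_nonneg_left (by nlinarith) (sq_nonneg _)
    rw [abs_le]; constructor <;> linarith

/-- Mixtures with fewer than `k` components are padded by zero terms, so one grid serves all sizes.
-/
lemma sum_fin_dite_lt {n k : ℕ} (hnk : n ≤ k) (F : Fin n → ℝ) :
    ∑ i : Fin k, (if h : (i : ℕ) < n then F ⟨i, h⟩ else 0) = ∑ i, F i := by
  rw [Finset.sum_fin_eq_sum_range, Finset.sum_fin_eq_sum_range]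
  symm
  refine Finset.sum_subset_zero_on_sdiff (Finset.range_mono hnk) (fun i hi => ?_) fun i hi => ?_
  · simp only [Finset.mem_sdiff, Finset.mem_range] at hi
    simp [hi.2]
  · have h1 := Finset.mem_range.1 hi
    simp [h1, h1.trans_le hnk]

/-- The bound is `log (s' / s) ≤ s' / s - 1 ≤ τ / s`. -/
lemma abs_log_sub_log_le {s s' τ b : ℝ} (hs : Real.exp (-b) ≤ s) (hss' : s ≤ s')
    (hs' : s' ≤ s + τ) : |Real.log s - Real.log s'| ≤ τ * Real.exp b := by
  have hpos : 0 < s := (Real.exp_pos _).trans_le hs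
  have hpos' : 0 < s' := hpos.trans_le hss'
  have hτ : 0 ≤ τ := by linarith
  have h1 := Real.log_le_log hpos hss'
  have h2 := Real.log_le_sub_one_of_pos (div_pos hpos' hpos)
  rw [Real.log_div hpos'.ne' hpos.ne'] at h2
  have h3 : s' / s - 1 ≤ τ * Real.exp b := by
    have h4 : s' / s - 1 = (s' - s) / s := by field_simp
    have h5 : 1 ≤ Real.exp b * s := by
      calc (1 : ℝ) = Real.exp b * Real.exp (-b) := by rw [← Real.exp_add]; simp
        _ ≤ _ := by gcongr
    rw [h4, div_le_iff₀ hpos]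
    nlinarith
  rw [abs_sub_comm, abs_of_nonneg (by linarith)]
  linarith

/-- On a ball where its score is at least `-b`, a controlled mixture score is approximated by a
log-sum-exp of `k` quadratic polynomials with bounded coefficients: the terms smaller than
`exp (-T)` on the whole ball are replaced by that constant. -/
lemma MixtureParams.IsControlled.exists_logSumExpFeatures_approx {θ : MixtureParams d} {Q : ℝ}
    (h : θ.IsControlled Q) {k : ℕ} (hk : θ.size ≤ k) {x₀ : EuclideanSpace ℝ (Fin d)}
    {R T V b : ℝ} (hR : 0 ≤ R) (hT : 0 ≤ T) (hV : R + 1 + 2 * Q * (T + Q ^ 2) ≤ V)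
    (hb : ∀ x ∈ Metric.closedBall x₀ R, -b ≤ mixtureScore θ x) :
    ∃ w : Fin k → Option (Fin d ⊕ Fin d × Fin d) → ℝ,
      (∀ i s, |w i s| ≤ T + 5 * Q ^ 2 + Q ^ 2 * V ^ 2) ∧
      ∀ x ∈ Metric.closedBall x₀ R,
        |mixtureScore θ x - logSumExpFeatures (quadraticFeature x₀) w x| ≤
          k * Real.exp (-T) * Real.exp b := by
  classical
  have hQ := h.one_le
  let term : Fin θ.size → EuclideanSpace ℝ (Fin d) → ℝ := fun i x =>
    θ.weight i * gaussianDensity (θ.mean i) (θ.cov i) x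
  let ext : Fin k → EuclideanSpace ℝ (Fin d) → ℝ := fun i x =>
    if hi : (i : ℕ) < θ.size then term ⟨i, hi⟩ x else 0
  have key : ∀ i : Fin k, ∃ w : Option (Fin d ⊕ Fin d × Fin d) → ℝ,
      (∀ s, |w s| ≤ T + 5 * Q ^ 2 + Q ^ 2 * V ^ 2) ∧
      ∀ x ∈ Metric.closedBall x₀ R,
        ext i x ≤ Real.exp (∑ s, w s * quadraticFeature x₀ s x) ∧
        Real.exp (∑ s, w s * quadraticFeature x₀ s x) ≤ ext i x + Real.exp (-T) := by
    intro i
    by_cases hbig : ∃ z ∈ Metric.closedBall x₀ R, Real.exp (-T) < ext i z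
    · obtain ⟨z, hz, hlt⟩ := hbig
      have hi : (i : ℕ) < θ.size := by
        by_contra hi
        simp only [ext, hi, dite_false] at hlt
        exact absurd hlt (not_lt.2 (Real.exp_pos _).le)
      have hext : ext i = term ⟨i, hi⟩ := by funext x; simp only [ext, hi, dite_true]
      rw [hext] at hlt ⊢
      set i' : Fin θ.size := ⟨i, hi⟩
      obtain ⟨hpos, hlog, hmean⟩ := h.bounds_of_exp_le_term (i := i') hlt.le
      have hmean' : ‖θ.mean i' - x₀‖ ≤ V := by
        have h1 : ‖z - x₀‖ ≤ R := by simpa [dist_eq_norm] using hz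
        have h2 : ‖θ.mean i' - x₀‖ ≤ ‖z - x₀‖ + ‖z - θ.mean i'‖ := by
          rw [show θ.mean i' - x₀ = (z - x₀) - (z - θ.mean i') by abel]
          exact norm_sub_le _ _
        -- The bound `t ≤ 1 + t ^ 2` avoids a square root; this is the origin of the form of `V`.
        nlinarith [sq_nonneg (‖z - θ.mean i'‖ - 1)]
      have hV1 : 1 ≤ V := by
        have : 0 ≤ 2 * Q * (T + Q ^ 2) := by positivity
        linarith
      have hquad : |(θ.mean i' - x₀).ofLp ⬝ᵥ (θ.cov i')⁻¹.mulVec (θ.mean i' - x₀).ofLp| ≤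
          Q * ‖θ.mean i' - x₀‖ ^ 2 := by
        rw [abs_of_nonneg (h.quad_nonneg i' _)]
        exact h.quad_le i' _
      have hr : |Real.log (θ.weight i') + gaussianLogNormalizer (θ.cov i')| ≤ T + 5 * Q ^ 2 := by
        have h1 := h.le_logNormalizer i'
        have h2 := h.logNormalizer_le i'
        have h3 : Real.log (θ.weight i') ≤ 0 := Real.log_nonpos hpos.le (h.weight_le_one i')
        rw [abs_le]; constructor <;> nlinarith
      refine ⟨quadraticCoeff (Real.log (θ.weight i') + gaussianLogNormalizer (θ.cov i'))
        (θ.cov i')⁻¹ (θ.mean i' - x₀).ofLp,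
        abs_quadraticCoeff_le hQ h.dim_le hr (h.abs_inv_le i') hquad hmean' hV1, fun x _ => ?_⟩
      have heq : Real.exp (∑ s, quadraticCoeff
          (Real.log (θ.weight i') + gaussianLogNormalizer (θ.cov i'))
          (θ.cov i')⁻¹ (θ.mean i' - x₀).ofLp s * quadraticFeature x₀ s x) = term i' x := by
        rw [sum_quadraticCoeff_mul, add_sub_assoc, Real.exp_add, Real.exp_log hpos,
          ← h.density_eq]
      rw [heq]
      exact ⟨le_rfl, by linarith [Real.exp_pos (-T)]⟩
    -- This case also covers the padding and vanishing weights; the replacement is the constant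
    -- polynomial `-T`.
    · push Not at hbig
      refine ⟨quadraticCoeff (-T) 0 0, fun s => (abs_quadraticCoeff_zero_le _ s).trans ?_,
        fun x hx => ?_⟩
      · rw [abs_neg, abs_of_nonneg hT]
        have : 0 ≤ Q ^ 2 * V ^ 2 := by positivity
        nlinarith
      · rw [sum_quadraticCoeff_zero_mul]
        refine ⟨hbig x hx, ?_⟩
        have : 0 ≤ ext i x := by
          simp only [ext]
          split_ifs with hi
          · exact h.term_nonneg _ x
          · exact le_rfl
        linarith
  choose w hw hwx using key
  refine ⟨w, hw, fun x hx => ?_⟩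
  have hsum : ∑ i, ext i x = ∑ i, term i x := sum_fin_dite_lt hk fun i => term i x
  have h1 : ∑ i, term i x ≤ ∑ i, Real.exp (∑ s, w i s * quadraticFeature x₀ s x) := by
    rw [← hsum]
    exact Finset.sum_le_sum fun i _ => (hwx i x hx).1
  have h2 : ∑ i, Real.exp (∑ s, w i s * quadraticFeature x₀ s x) ≤
      ∑ i, term i x + k * Real.exp (-T) := by
    calc _ ≤ ∑ i, (ext i x + Real.exp (-T)) := Finset.sum_le_sum fun i _ => (hwx i x hx).2
      _ = _ := by rw [Finset.sum_add_distrib, hsum]; simp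
  exact abs_log_sub_log_le (h.exp_le_mixture (hb x hx)) h1 h2

end QuadraticFeatures

/-! ### Empirical measures -/

section Empirical

variable {d m : ℕ}

lemma integral_empiricalMeasure (x : Fin m → EuclideanSpace ℝ (Fin d))
    (f : EuclideanSpace ℝ (Fin d) → ℝ) :
    ∫ y, f y ∂(empiricalMeasure x) = (m : ℝ)⁻¹ * ∑ j, f (x j) := by
  rw [empiricalMeasure, integral_smul_measure,
    integral_finsetSum_measure fun j _ => integrable_dirac (by simp)]
  simp

lemma isProbabilityMeasure_empiricalMeasure (hm : 0 < m)
    (x : Fin m → EuclideanSpace ℝ (Fin d)) : IsProbabilityMeasure (empiricalMeasure x) := by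
  constructor
  simp only [empiricalMeasure, Measure.smul_apply, Measure.coe_finsetSum, Finset.sum_apply,
    measure_univ, Finset.sum_const, Finset.card_univ, Fintype.card_fin, nsmul_eq_mul, mul_one,
    smul_eq_mul]
  exact ENNReal.inv_mul_cancel (by simpa using hm.ne') (by simp)

/-- With high probability, a set of probability at least `3/4` has empirical probability at least
`1/2`. -/
lemma exists_measurableSet_half_le_empiricalMeasure (hm : 0 < m)
    (ρ : Measure (EuclideanSpace ℝ (Fin d))) [IsProbabilityMeasure ρ]
    {B : Set (EuclideanSpace ℝ (Fin d))} (hB : MeasurableSet B) (hρB : 3 / 4 ≤ ρ.real B)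
    {δ : ℝ} (hδ : 0 < δ) (hmδ : 8 * Real.log (1 / δ) ≤ m) :
    ∃ G : Set (Fin m → EuclideanSpace ℝ (Fin d)), MeasurableSet G ∧
      (Measure.pi fun _ : Fin m => ρ) Gᶜ ≤ ENNReal.ofReal (2 * δ) ∧
      ∀ x ∈ G, 1 / 2 ≤ (empiricalMeasure x).real B := by
  have hm' : (0 : ℝ) < m := by exact_mod_cast hm
  -- Centring at `1 / 2` halves the sup bound, so deviation `1 / 4` has Hoeffding exponent exactly
  -- `-m / 8`.
  let g : EuclideanSpace ℝ (Fin d) → ℝ := fun y => B.indicator (fun _ => (1 : ℝ)) y - 1 / 2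
  have hg : Measurable g := (measurable_const.indicator hB).sub_const _
  have hgb : ∀ y, |g y| ≤ 1 / 2 := by
    intro y
    by_cases hy : y ∈ B
    · simp only [g, Set.indicator_of_mem hy]; norm_num [abs_le]
    · simp only [g, Set.indicator_of_notMem hy]; norm_num [abs_le]
  have hgint : ∀ ν : Measure (EuclideanSpace ℝ (Fin d)), IsProbabilityMeasure ν →
      ∫ y, g y ∂ν = ν.real B - 1 / 2 := by
    intro ν _
    rw [integral_sub ((integrable_const _).indicator hB) (integrable_const _),
      integral_indicator_const _ hB]
    simp
  have hmeas : MeasurableSet {x : Fin m → EuclideanSpace ℝ (Fin d) |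
      1 / 4 ≤ |∫ y, g y ∂ρ - (m : ℝ)⁻¹ * ∑ j, g (x j)|} := by
    refine measurableSet_le measurable_const ?_
    have : Measurable fun x : Fin m → EuclideanSpace ℝ (Fin d) => ∑ j, g (x j) :=
      Finset.measurable_sum _ fun j _ => hg.comp (measurable_pi_apply j)
    exact (measurable_const.sub (this.const_mul _)).abs
  refine ⟨_, hmeas.compl, ?_, fun x hx => ?_⟩
  · rw [compl_compl]
    refine (measure_pi_abs_integral_sub_mean_ge_le ρ hm hg hgb (by norm_num)).trans ?_
    apply ENNReal.ofReal_le_ofReal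
    have h1 : Real.exp (-(m * (1 / 4) ^ 2) / (2 * (1 / 2) ^ 2)) ≤ δ := by
      rw [← Real.le_log_iff_exp_le hδ]
      rw [one_div, Real.log_inv] at hmδ
      rw [show -(m * (1 / 4) ^ 2) / (2 * (1 / 2) ^ 2) = -((m : ℝ) / 8) by ring]
      linarith
    linarith
  · have hx' : |∫ y, g y ∂ρ - (m : ℝ)⁻¹ * ∑ j, g (x j)| < 1 / 4 := not_le.1 hx
    have := isProbabilityMeasure_empiricalMeasure hm x
    rw [← integral_empiricalMeasure, hgint ρ inferInstance, hgint _ this, abs_lt] at hx'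
    linarith [hx'.2]

end Empirical

/-! ### Tail bounds from moments -/

section Moments

variable {d : ℕ} {ρ : Measure (EuclideanSpace ℝ (Fin d))} {p : ℕ} {M : ℝ}

lemma HasMomentBound.nonneg (h : HasMomentBound ρ p M) (hp : 1 ≤ p) : 0 ≤ M :=
  (integral_nonneg fun x => by positivity).trans (h 1 le_rfl hp).2

lemma HasMomentBound.pow_mul_measureReal_compl_closedBall_le [IsProbabilityMeasure ρ]
    (h : HasMomentBound ρ p M) {l : ℕ} (hl : 1 ≤ l) (hlp : l ≤ p) {R : ℝ} (hR : 0 ≤ R) :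
    R ^ l * ρ.real (Metric.closedBall (∫ y, y ∂ρ) R)ᶜ ≤ M := by
  refine le_trans ?_ (h l hl hlp).2
  refine le_trans ?_ (mul_meas_ge_le_integral_of_nonneg
    (Filter.Eventually.of_forall fun x => by positivity) (h l hl hlp).1 (R ^ l))
  refine mul_le_mul_of_nonneg_left (measureReal_mono fun x hx => ?_) (by positivity)
  have hx' : R < ‖x - ∫ y, y ∂ρ‖ := by simpa [dist_eq_norm] using hx
  exact pow_le_pow_left₀ hR hx'.le l

/-- With high probability, the whole sample lies in a large ball. -/
lemma exists_measurableSet_forall_mem_closedBall [IsProbabilityMeasure ρ]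
    (h : HasMomentBound ρ p M) (hp : 1 ≤ p) {m : ℕ} {R δ : ℝ} (hR : 0 < R)
    (hRp : m * M ≤ δ * R ^ p) :
    ∃ G : Set (Fin m → EuclideanSpace ℝ (Fin d)), MeasurableSet G ∧
      (Measure.pi fun _ : Fin m => ρ) Gᶜ ≤ ENNReal.ofReal δ ∧
      ∀ x ∈ G, ∀ j, x j ∈ Metric.closedBall (∫ y, y ∂ρ) R := by
  set B := Metric.closedBall (∫ y, y ∂ρ) R
  have hB : MeasurableSet Bᶜ := Metric.isClosed_closedBall.measurableSet.compl
  have hA (j : Fin m) : MeasurableSet ((fun x : Fin m → EuclideanSpace ℝ (Fin d) => x j) ⁻¹' Bᶜ) :=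
    measurable_pi_apply j hB
  refine ⟨(⋃ j, (fun x => x j) ⁻¹' Bᶜ)ᶜ, (MeasurableSet.iUnion hA).compl, ?_, fun x hx j => ?_⟩
  · rw [compl_compl]
    have h1 := h.pow_mul_measureReal_compl_closedBall_le hp le_rfl hR.le
    have hRpos : 0 < R ^ p := by positivity
    have h2 : m * ρ.real Bᶜ ≤ δ := by
      have h3 : R ^ p * (m * ρ.real Bᶜ) ≤ R ^ p * δ := by
        have := mul_le_mul_of_nonneg_left h1 (Nat.cast_nonneg (α := ℝ) m)
        linarith
      exact le_of_mul_le_mul_left h3 hRpos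
    calc _ ≤ ∑ j, (Measure.pi fun _ : Fin m => ρ) ((fun x => x j) ⁻¹' Bᶜ) :=
          measure_iUnion_fintype_le _ _
      _ = ∑ _j : Fin m, ρ Bᶜ := Finset.sum_congr rfl fun j _ =>
          (measurePreserving_eval (fun _ : Fin m => ρ) j).measure_preimage hB.nullMeasurableSet
      _ = ENNReal.ofReal (m * ρ.real Bᶜ) := by
          rw [Finset.sum_const, nsmul_eq_mul, Finset.card_univ, Fintype.card_fin,
            ENNReal.ofReal_mul (Nat.cast_nonneg _), ENNReal.ofReal_natCast, ofReal_measureReal]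
      _ ≤ _ := ENNReal.ofReal_le_ofReal h2
  · by_contra hj
    exact hx (Set.mem_iUnion.2 ⟨j, hj⟩)

lemma HasMomentBound.integrable_of_abs_le [IsProbabilityMeasure ρ] (h : HasMomentBound ρ p M)
    (hp : 2 ≤ p) {f : EuclideanSpace ℝ (Fin d) → ℝ} (hf : Measurable f) {A : ℝ}
    (hfA : ∀ x, |f x| ≤ A * (1 + ‖x - ∫ y, y ∂ρ‖ ^ 2)) : Integrable f ρ :=
  (((integrable_const (1 : ℝ)).add (h 2 one_le_two hp).1).const_mul A).mono'
    hf.aestronglyMeasurable (Filter.Eventually.of_forall hfA)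

/-- A function of quadratic growth has a small integral outside a large ball. -/
lemma HasMomentBound.abs_setIntegral_compl_closedBall_le [IsProbabilityMeasure ρ]
    (h : HasMomentBound ρ p M) {n : ℕ} (hn : 2 ≤ n) (hpn : p = 2 * n)
    {f : EuclideanSpace ℝ (Fin d) → ℝ} {A R : ℝ} (hA : 0 ≤ A) (hR : 1 ≤ R)
    (hfA : ∀ x, |f x| ≤ A * (1 + ‖x - ∫ y, y ∂ρ‖ ^ 2)) :
    |∫ x in (Metric.closedBall (∫ y, y ∂ρ) R)ᶜ, f x ∂ρ| ≤ 2 * A * M / R ^ n := by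
  set x₀ := ∫ y, y ∂ρ
  have hB : MeasurableSet (Metric.closedBall x₀ R)ᶜ :=
    Metric.isClosed_closedBall.measurableSet.compl
  have hRn : 0 < R ^ n := by positivity
  have hint : Integrable (fun x => 2 * A / R ^ n * ‖x - x₀‖ ^ p) ρ :=
    (h p (by omega) le_rfl).1.const_mul _
  have hpt : ∀ x ∈ (Metric.closedBall x₀ R)ᶜ, ‖f x‖ ≤ 2 * A / R ^ n * ‖x - x₀‖ ^ p := by
    intro x hx
    have hx' : R < ‖x - x₀‖ := by simpa [dist_eq_norm] using hx
    set r := ‖x - x₀‖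
    have hr1 : 1 ≤ r := hR.trans hx'.le
    have h1 : 1 + r ^ 2 ≤ 2 * r ^ 2 := by nlinarith
    -- Half of the `p` moments absorbs the quadratic growth; the other half supplies the decay `R ^
    -- (-n)`.
    have h2 : r ^ 2 * R ^ n ≤ r ^ p := by
      calc r ^ 2 * R ^ n ≤ r ^ n * r ^ n := mul_le_mul (pow_le_pow_right₀ hr1 hn)
            (pow_le_pow_left₀ (by linarith) hx'.le n) hRn.le (by positivity)
        _ = r ^ p := by rw [hpn, two_mul, pow_add]
    calc ‖f x‖ ≤ A * (1 + r ^ 2) := hfA x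
      _ ≤ A * (2 * r ^ 2) := mul_le_mul_of_nonneg_left h1 hA
      _ ≤ 2 * A / R ^ n * r ^ p := by
        rw [div_mul_eq_mul_div, le_div_iff₀ hRn]
        nlinarith [mul_le_mul_of_nonneg_left h2 hA]
  calc _ ≤ ∫ x in (Metric.closedBall x₀ R)ᶜ, 2 * A / R ^ n * ‖x - x₀‖ ^ p ∂ρ :=
        norm_integral_le_of_norm_le hint.integrableOn
          ((ae_restrict_iff' hB).2 (Filter.Eventually.of_forall hpt))
    _ ≤ ∫ x, 2 * A / R ^ n * ‖x - x₀‖ ^ p ∂ρ :=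
        setIntegral_le_integral hint (Filter.Eventually.of_forall fun x => by positivity)
    _ = 2 * A / R ^ n * ∫ x, ‖x - x₀‖ ^ p ∂ρ := integral_const_mul _ _
    _ ≤ 2 * A / R ^ n * M :=
        mul_le_mul_of_nonneg_left (h p (by omega) le_rfl).2 (by positivity)
    _ = _ := by ring

end Moments

/-! ### Uniform deviation on a ball -/

section Deviation

/-- The number of grid values per coefficient is polynomial in `Q`, `R` and `m`; only its logarithm
enters the rate. -/
lemma grid_size_le {Q R m D T V W : ℝ} (hQ : 1 ≤ Q) (hR : 1 ≤ R) (hm : 1 ≤ m) (hD : 1 ≤ D)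
    (hDQ : D ≤ Q ^ 2) (hT : T = 200 * Q ^ 4 * R ^ 2 + Q + m)
    (hV : V = R + 1 + 2 * Q * (T + Q ^ 2)) (hW : W = T + 5 * Q ^ 2 + Q ^ 2 * V ^ 2) :
    2 * (W * (m * D * R ^ 2) + 2) + 1 ≤ 2 ^ 21 * (Q ^ 14 * R ^ 6 * m ^ 3) := by
  have hQ4 : Q ≤ Q ^ 4 := le_self_pow₀ hQ (by norm_num)
  have hQ24 : Q ^ 2 ≤ Q ^ 4 := pow_le_pow_right₀ hQ (by norm_num)
  have h1Q4 : 1 ≤ Q ^ 4 := one_le_pow₀ hQ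
  have hR2 : 1 ≤ R ^ 2 := one_le_pow₀ hR
  have hRR : R ≤ R ^ 2 := le_self_pow₀ hR (by norm_num)
  have hRm : 1 ≤ R ^ 2 * m := one_le_mul_of_one_le_of_one_le hR2 hm
  have hA1 : Q ^ 4 ≤ Q ^ 4 * (R ^ 2 * m) := le_mul_of_one_le_right (by linarith) hRm
  have hA2 : Q ^ 4 * R ^ 2 ≤ Q ^ 4 * (R ^ 2 * m) :=
    mul_le_mul_of_nonneg_left (le_mul_of_one_le_right (by linarith) hm) (by linarith)
  have hA3 : m ≤ Q ^ 4 * (R ^ 2 * m) :=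
    (le_mul_of_one_le_left (by linarith) hR2).trans (le_mul_of_one_le_left (by linarith) h1Q4)
  have hA4 : R ≤ Q ^ 4 * (R ^ 2 * m) :=
    (hRR.trans (le_mul_of_one_le_right (by linarith) hm)).trans
      (le_mul_of_one_le_left (by linarith) h1Q4)
  have hT0 : 0 ≤ T := by rw [hT]; positivity
  have hTle : T ≤ 202 * (Q ^ 4 * (R ^ 2 * m)) := by rw [hT]; linarith
  have hV0 : 0 ≤ V := by rw [hV]; positivity
  have hVle : V ≤ 408 * (Q ^ 5 * (R ^ 2 * m)) := by
    have h1 : 2 * Q * (T + Q ^ 2) ≤ 2 * Q * (203 * (Q ^ 4 * (R ^ 2 * m))) :=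
      mul_le_mul_of_nonneg_left (by linarith) (by linarith)
    have h2 : Q ^ 4 * (R ^ 2 * m) ≤ Q ^ 5 * (R ^ 2 * m) :=
      mul_le_mul_of_nonneg_right (pow_le_pow_right₀ hQ (by norm_num)) (by linarith)
    rw [hV]
    linarith
  have hV2 : Q ^ 2 * V ^ 2 ≤ 166464 * (Q ^ 12 * R ^ 4 * m ^ 2) := by
    calc Q ^ 2 * V ^ 2 ≤ Q ^ 2 * (408 * (Q ^ 5 * (R ^ 2 * m))) ^ 2 :=
          mul_le_mul_of_nonneg_left (pow_le_pow_left₀ hV0 hVle 2) (sq_nonneg _)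
      _ = _ := by ring
  have hbig : Q ^ 4 * (R ^ 2 * m) ≤ Q ^ 12 * R ^ 4 * m ^ 2 := by
    rw [mul_assoc]
    exact mul_le_mul (pow_le_pow_right₀ hQ (by norm_num)) (mul_le_mul
      (pow_le_pow_right₀ hR (by norm_num)) (le_self_pow₀ hm (by norm_num)) (by linarith)
      (by positivity)) (by positivity) (by positivity)
  have hWle : W ≤ 200000 * (Q ^ 12 * R ^ 4 * m ^ 2) := by
    rw [hW]; linarith
  have hW0 : 0 ≤ W := by rw [hW]; positivity
  have hprod : W * (m * D * R ^ 2) ≤ 200000 * (Q ^ 14 * R ^ 6 * m ^ 3) := by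
    calc W * (m * D * R ^ 2) ≤ 200000 * (Q ^ 12 * R ^ 4 * m ^ 2) * (m * Q ^ 2 * R ^ 2) := by
          gcongr
      _ = _ := by ring
  have hone : 1 ≤ Q ^ 14 * R ^ 6 * m ^ 3 :=
    one_le_mul_of_one_le_of_one_le (one_le_mul_of_one_le_of_one_le (one_le_pow₀ hQ)
      (one_le_pow₀ hR)) (one_le_pow₀ hm)
  linarith

/-- Uniform deviation, on a ball containing the sample, of the scores of controlled mixtures. -/
lemma exists_measurableSet_mixtureScore_deviation {d m k : ℕ}
    (ρ : Measure (EuclideanSpace ℝ (Fin d))) [IsProbabilityMeasure ρ] (hm : 0 < m) (hk : 0 < k)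
    (x₀ : EuclideanSpace ℝ (Fin d)) {Q R δ L : ℝ} (hQ : 1 ≤ Q) (hdQ : d + 1 ≤ Q)
    (hkQ : k ≤ Q) (hR : 1 ≤ R) (hδ : 0 < δ) (hL0 : 0 ≤ L)
    (hL : Real.log 2 + Q ^ 3 * Real.log (2 ^ 21 * (Q ^ 14 * R ^ 6 * m ^ 3)) +
      Real.log (1 / δ) ≤ L) :
    ∃ G : Set (Fin m → EuclideanSpace ℝ (Fin d)), MeasurableSet G ∧
      (Measure.pi fun _ : Fin m => ρ) Gᶜ ≤ ENNReal.ofReal δ ∧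
      ∀ x ∈ G, (∀ j, x j ∈ Metric.closedBall x₀ R) → ∀ θ : MixtureParams d,
        θ.IsControlled Q → θ.size ≤ k →
        (∀ y, |mixtureScore θ y| ≤ 100 * Q ^ 4 * (1 + ‖y - x₀‖ ^ 2)) →
        |∫ y in Metric.closedBall x₀ R, mixtureScore θ y ∂ρ -
          (m : ℝ)⁻¹ * ∑ j, mixtureScore θ (x j)| ≤
          200 * Q ^ 4 * R ^ 2 * Real.sqrt (2 * L / m) + 4 / m := by
  have hm1 : (1 : ℝ) ≤ m := by exact_mod_cast hm
  have hd0 : (0 : ℝ) ≤ d := Nat.cast_nonneg d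
  set D : ℝ := (Fintype.card (Option (Fin d ⊕ Fin d × Fin d)) : ℝ) with hDdef
  have hD : D = d + d * d + 1 := by rw [hDdef, card_quadraticFeature]; push_cast; ring
  have hD1 : 1 ≤ D := by rw [hD]; nlinarith
  have hDQ : D ≤ Q ^ 2 := by
    have := pow_le_pow_left₀ (by linarith) hdQ 2
    rw [hD]; nlinarith
  -- `b` bounds the scores on the ball, `T = b + Q + m` makes the truncation error at most `1 / m`,
  -- and the mesh `η` makes the rounding error exactly `1 / m`; each is counted twice, giving `4 /
  -- m`.
  obtain ⟨b, hb⟩ : ∃ b, b = 200 * Q ^ 4 * R ^ 2 := ⟨_, rfl⟩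
  obtain ⟨T, hT⟩ : ∃ T, T = 200 * Q ^ 4 * R ^ 2 + Q + m := ⟨_, rfl⟩
  obtain ⟨V, hV⟩ : ∃ V, V = R + 1 + 2 * Q * (T + Q ^ 2) := ⟨_, rfl⟩
  obtain ⟨W, hW⟩ : ∃ W, W = T + 5 * Q ^ 2 + Q ^ 2 * V ^ 2 := ⟨_, rfl⟩
  obtain ⟨η, hη⟩ : ∃ η, η = 1 / (m * D * R ^ 2) := ⟨_, rfl⟩
  have hT0 : 0 ≤ T := by rw [hT]; positivity
  have hW0 : 0 ≤ W := by rw [hW]; positivity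
  have hη0 : 0 < η := by rw [hη]; positivity
  have hb0 : 0 < b := by rw [hb]; positivity
  set J := ⌈W / η + 1⌉₊ with hJdef
  have hJ : W / η + 1 ≤ J := Nat.le_ceil _
  have hWη : W / η = W * (m * D * R ^ 2) := by rw [hη, div_div_eq_mul_div, div_one]
  have hJ' : 2 * (J : ℝ) + 1 ≤ 2 ^ 21 * (Q ^ 14 * R ^ 6 * m ^ 3) := by
    have h1 : (J : ℝ) < W / η + 1 + 1 := Nat.ceil_lt_add_one (by positivity)
    have h2 := grid_size_le hQ hR hm1 hD1 hDQ hT hV hW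
    rw [hWη] at h1
    linarith
  -- There are `k * D ≤ Q ^ 3` coefficients, each with `2 * J + 1` grid values.
  have hcard : 2 * (2 * (J : ℝ) + 1) ^ (k * Fintype.card (Option (Fin d ⊕ Fin d × Fin d))) ≤
      δ * Real.exp L := by
    have hpos : (0 : ℝ) < 2 * J + 1 := by positivity
    have hlog0 : 0 ≤ Real.log (2 * (J : ℝ) + 1) :=
      Real.log_nonneg (by linarith [Nat.cast_nonneg (α := ℝ) J])
    have h1 : (k : ℝ) * D ≤ Q ^ 3 := by
      calc (k : ℝ) * D ≤ Q * Q ^ 2 := by gcongr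
        _ = Q ^ 3 := by ring
    have h2 : (k : ℝ) * D * Real.log (2 * (J : ℝ) + 1) ≤
        Q ^ 3 * Real.log (2 ^ 21 * (Q ^ 14 * R ^ 6 * m ^ 3)) :=
      mul_le_mul h1 (Real.log_le_log hpos hJ') hlog0 (by positivity)
    have hne : (2 * (J : ℝ) + 1) ^ (k * Fintype.card (Option (Fin d ⊕ Fin d × Fin d))) ≠ 0 := by
      positivity
    have h3 : Real.log (2 * (2 * (J : ℝ) + 1) ^
        (k * Fintype.card (Option (Fin d ⊕ Fin d × Fin d)))) ≤ Real.log (δ * Real.exp L) := by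
      rw [Real.log_mul two_ne_zero hne, Real.log_pow, Real.log_mul hδ.ne' (Real.exp_pos L).ne',
        Real.log_exp, Nat.cast_mul]
      rw [one_div, Real.log_inv] at hL
      linarith
    exact (Real.log_le_log_iff (by positivity) (by positivity)).1 h3
  have hηΦ : D * (η * R ^ 2) = 1 / m := by
    rw [hη]; field_simp
  have hballnorm : ∀ y ∈ Metric.closedBall x₀ R, ‖y - x₀‖ ≤ R := fun y hy => by
    simpa [dist_eq_norm] using hy
  have hε : (k : ℝ) * Real.exp (-T) * Real.exp b ≤ 1 / m := by
    have h1 : (k : ℝ) ≤ Real.exp Q := hkQ.trans (by linarith [Real.add_one_le_exp Q])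
    have h2 : (m : ℝ) ≤ Real.exp m := by linarith [Real.add_one_le_exp (m : ℝ)]
    rw [le_div_iff₀ (by linarith)]
    calc (k : ℝ) * Real.exp (-T) * Real.exp b * m
        ≤ Real.exp Q * Real.exp (-T) * Real.exp b * Real.exp m := by gcongr
      _ = 1 := by
        rw [← Real.exp_add, ← Real.exp_add, ← Real.exp_add, hT, hb, ← Real.exp_zero]
        congr 1; ring
  obtain ⟨G, hG, hGδ, hdev⟩ := exists_measurableSet_logSumExpFeatures_deviation ρ hm hk
    (measurable_quadraticFeature x₀) (B := Metric.closedBall x₀ R)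
    Metric.isClosed_closedBall.measurableSet (Φ := R ^ 2) (b := b) (W := W) (η := η) (δ := δ)
    (L := L) (ε := 1 / m)
    (fun y hy s => abs_quadraticFeature_le hR (hballnorm y hy) s) hb0 hη0 hJ hL0 hcard
    (by positivity)
  refine ⟨G, hG, hGδ, fun x hx hxB θ hθ hsize hgrowth => ?_⟩
  have hfb : ∀ y ∈ Metric.closedBall x₀ R, |mixtureScore θ y| ≤ b := by
    intro y hy
    refine (hgrowth y).trans ?_
    have h1 := pow_le_pow_left₀ (norm_nonneg _) (hballnorm y hy) 2
    have h2 : 1 ≤ R ^ 2 := one_le_pow₀ hR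
    have h3 : 100 * Q ^ 4 * (1 + ‖y - x₀‖ ^ 2) ≤ 100 * Q ^ 4 * (R ^ 2 + R ^ 2) := by gcongr
    rw [hb]; linarith
  obtain ⟨w, hw, hwx⟩ := hθ.exists_logSumExpFeatures_approx hsize (by linarith) hT0 hV.ge
    (fun y hy => (abs_le.1 (hfb y hy)).1)
  have := hdev x hx hxB _ (measurable_mixtureScore θ) hfb
    ⟨w, fun i s => (hw i s).trans hW.ge, fun y hy => (hwx y hy).trans hε⟩
  refine this.trans (le_of_eq ?_)
  rw [← hDdef, hηΦ, hb]
  ring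

end Deviation

/-! ### Logarithms absorbed into powers; the final rate -/

section Rates

/-- The logarithm of the size of the grid grows slowly. -/
lemma log_grid_size_le {Q R X Y m δ : ℝ} (hQ : 1 ≤ Q) (hX : 1 ≤ X) (hY : 1 ≤ Y) (hR : 1 ≤ R)
    (hRle : R ≤ Q * X * Y) (hm : 1 ≤ m) (hlogm : Real.log m ≤ Q * X)
    (hlogδ : Real.log (1 / δ) ≤ Q * Y) :
    Real.log 2 + Q ^ 3 * Real.log (2 ^ 21 * (Q ^ 14 * R ^ 6 * m ^ 3)) + Real.log (1 / δ) ≤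
      46 * (Q ^ 4 * X * Y) := by
  have hexp : Real.log (2 ^ 21 * (Q ^ 14 * R ^ 6 * m ^ 3)) =
      21 * Real.log 2 + (14 * Real.log Q + 6 * Real.log R + 3 * Real.log m) := by
    rw [Real.log_mul (by positivity) (by positivity), Real.log_mul (by positivity) (by positivity),
      Real.log_mul (by positivity) (by positivity), Real.log_pow, Real.log_pow, Real.log_pow,
      Real.log_pow]
    norm_num
  have h2 : Real.log 2 ≤ 1 := by linarith [Real.log_two_lt_d9]
  have hlQ := Real.log_le_sub_one_of_pos (by linarith : 0 < Q)
  have hlR := Real.log_le_sub_one_of_pos (by linarith : 0 < R)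
  have hXY : 1 ≤ X * Y := one_le_mul_of_one_le_of_one_le hX hY
  have hQX : Q * X ≤ Q * X * Y := le_mul_of_one_le_right (by positivity) hY
  have hQXY : Q ≤ Q * X * Y := by
    rw [mul_assoc]; exact le_mul_of_one_le_right (by linarith) hXY
  have hle : Real.log (2 ^ 21 * (Q ^ 14 * R ^ 6 * m ^ 3)) ≤ 44 * (Q * X * Y) := by
    rw [hexp]; linarith
  have h3 : Q ^ 3 * Real.log (2 ^ 21 * (Q ^ 14 * R ^ 6 * m ^ 3)) ≤ Q ^ 3 * (44 * (Q * X * Y)) :=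
    mul_le_mul_of_nonneg_left hle (by positivity)
  have h4 : Q * X * Y ≤ Q ^ 4 * X * Y := by
    rw [mul_assoc, mul_assoc]
    exact mul_le_mul_of_nonneg_right (le_self_pow₀ hQ (by norm_num)) (by positivity)
  have h5 : Q * Y ≤ Q * X * Y :=
    mul_le_mul_of_nonneg_right (le_mul_of_one_le_right (by linarith) hX) (by linarith)
  rw [show Q ^ 3 * (44 * (Q * X * Y)) = 44 * (Q ^ 4 * X * Y) by ring] at h3
  have h6 : Real.log 2 ≤ Q ^ 4 * X * Y := by linarith
  have h7 : Real.log (1 / δ) ≤ Q ^ 4 * X * Y := by linarith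
  exact (add_le_add (add_le_add h6 h3) h7).trans_eq (by ring)

lemma deviation_rate_le {Q R X Y m L : ℝ} (hQ : 1 ≤ Q) (hX : 1 ≤ X) (hY : 1 ≤ Y) (hR : 0 ≤ R)
    (hRle : R ≤ Q * X * Y) (hm : 0 < m) (hL : L ≤ 46 * (Q ^ 4 * X * Y)) :
    200 * Q ^ 4 * R ^ 2 * Real.sqrt (2 * L / m) ≤
      2000 * Q ^ 8 * (X ^ 3 * Y ^ 4) / Real.sqrt m := by
  have h1 : Real.sqrt (2 * L) ≤ 10 * Q ^ 2 * X * Y ^ 2 := by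
    rw [Real.sqrt_le_iff]
    refine ⟨by positivity, ?_⟩
    -- Rounding the exponents up to even ones makes the right side a perfect square and yields the
    -- exponents `3` and `4`.
    have h2 : Q ^ 4 * X * Y ≤ Q ^ 4 * X ^ 2 * Y ^ 4 := by
      gcongr
      · exact le_self_pow₀ hX (by norm_num)
      · exact le_self_pow₀ hY (by norm_num)
    calc 2 * L ≤ 100 * (Q ^ 4 * X ^ 2 * Y ^ 4) := by
          have : 0 ≤ Q ^ 4 * X * Y := by positivity
          linarith
      _ = _ := by ring
  have h3 : R ^ 2 ≤ (Q * X * Y) ^ 2 := pow_le_pow_left₀ hR hRle 2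
  rw [Real.sqrt_div' _ hm.le, ← mul_div_assoc]
  refine div_le_div_of_nonneg_right ?_ (Real.sqrt_nonneg m)
  calc 200 * Q ^ 4 * R ^ 2 * Real.sqrt (2 * L)
      ≤ 200 * Q ^ 4 * (Q * X * Y) ^ 2 * (10 * Q ^ 2 * X * Y ^ 2) := by gcongr
    _ = _ := by ring

/-- Write `log a = p * log (a ^ (1 / p))` and apply `log t ≤ t - 1`. -/
lemma log_le_natCast_mul_rpow_inv {a : ℝ} (ha : 0 < a) {p : ℕ} (hp : 0 < p) :
    Real.log a ≤ p * a ^ (p : ℝ)⁻¹ := by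
  have hp' : (0 : ℝ) < p := by exact_mod_cast hp
  have h := Real.log_le_sub_one_of_pos (Real.rpow_pos_of_pos ha (p : ℝ)⁻¹)
  rw [Real.log_rpow ha, inv_mul_eq_div, div_le_iff₀ hp'] at h
  nlinarith

lemma rate_eq {m δ : ℝ} (hm : 0 < m) (hδ : 0 < δ) (p : ℕ) :
    (m ^ (p : ℝ)⁻¹) ^ 3 * ((1 / δ) ^ (p : ℝ)⁻¹) ^ 4 / Real.sqrt m =
      m ^ (-(1 / 2 : ℝ) + 3 / p) * (1 / δ) ^ (4 / (p : ℝ)) := by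
  rw [← Real.rpow_natCast, ← Real.rpow_natCast, ← Real.rpow_mul hm.le,
    ← Real.rpow_mul (by positivity), Real.sqrt_eq_rpow, Real.rpow_add hm, Real.rpow_neg hm.le]
  push_cast
  rw [inv_mul_eq_div, inv_mul_eq_div]
  ring

end Rates

/-! ### Assembly of the bound -/

lemma not_mem_mogClass_zero {d : ℕ} {ν : Measure (EuclideanSpace ℝ (Fin d))} {c σ₁ σ₂ : ℝ}
    (θ : MixtureParams d) : θ ∉ mogClass ν c 0 σ₁ σ₂ := by
  rintro ⟨hsize, -, hsum, -⟩
  obtain ⟨n, w, μ, S⟩ := θ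
  obtain rfl : n = 0 := Nat.le_zero.1 hsize
  simp at hsum

lemma ofReal_le_measure_of_compl_le {Ω : Type*} [MeasurableSpace Ω] {P : Measure Ω}
    [IsProbabilityMeasure P] {G : Set Ω} (hG : MeasurableSet G) {a : ℝ}
    (ha : 0 ≤ a) (h : P Gᶜ ≤ ENNReal.ofReal a) : ENNReal.ofReal (1 - a) ≤ P G := by
  rw [prob_compl_eq_one_sub hG] at h
  rw [ENNReal.ofReal_sub _ ha, ENNReal.ofReal_one]
  exact tsub_le_iff_tsub_le.1 h

/-- Uniform deviation of the scores over both classes, in terms of a common bound `Q` of the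
parameters. -/
lemma exists_measurableSet_mogClass_deviation {d k p m : ℕ} {M σ₁ σ₂ c δ Q : ℝ}
    {ρ : Measure (EuclideanSpace ℝ (Fin d))} [IsProbabilityMeasure ρ] (hp : 8 ≤ p) (hp4 : 4 ∣ p)
    (hM : HasMomentBound ρ p M) (hσ₁ : 0 < σ₁) (hσ₂ : 0 < σ₂) (hk : 0 < k) (hm : 0 < m)
    (hδ : 0 < δ) (hδ1 : δ ≤ 1) (hmδ : 8 * Real.log (1 / δ) ≤ m)
    (hpQ : p ≤ Q) (hdQ : d + 1 ≤ Q) (hkQ : k ≤ Q) (hcQ : |c| ≤ Q) (hMQ : M + 1 ≤ Q)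
    (hσ₂Q : σ₂ ≤ Q) (hσ₁Q : 1 / σ₁ ≤ Q) :
    ∃ G : Set (Fin m → EuclideanSpace ℝ (Fin d)), MeasurableSet G ∧
      (Measure.pi fun _ : Fin m => ρ) Gᶜ ≤ ENNReal.ofReal (4 * δ) ∧
      ∀ x ∈ G, ∀ θ ∈ mogClass (empiricalMeasure x) c k σ₁ σ₂ ∪ mogClass ρ c k σ₁ σ₂,
        Integrable (mixtureScore θ) ρ ∧
        |∫ y, mixtureScore θ y ∂ρ - ∫ y, mixtureScore θ y ∂(empiricalMeasure x)| ≤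
          2204 * Q ^ 8 * ((m : ℝ) ^ (-(1 / 2 : ℝ) + 3 / p) * (1 / δ) ^ (4 / (p : ℝ))) := by
  have hp0 : p ≠ 0 := by omega
  have hM0 : 0 ≤ M := hM.nonneg (by omega)
  have hQ : 1 ≤ Q := by linarith
  have hm1 : (1 : ℝ) ≤ m := by exact_mod_cast hm
  have hm0 : (0 : ℝ) < m := by linarith
  have hδinv : 1 ≤ 1 / δ := by rwa [le_div_iff₀ hδ, one_mul]
  have hpinv : (0 : ℝ) ≤ (p : ℝ)⁻¹ := by positivity
  have hpinv1 : (p : ℝ)⁻¹ ≤ 1 := inv_le_one_of_one_le₀ (by exact_mod_cast (by omega : 1 ≤ p))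
  set x₀ := ∫ y, y ∂ρ with hx₀
  set X := (m : ℝ) ^ (p : ℝ)⁻¹ with hXdef
  set Y := (1 / δ) ^ (p : ℝ)⁻¹ with hYdef
  have hX : 1 ≤ X := Real.one_le_rpow hm1 hpinv
  have hY : 1 ≤ Y := Real.one_le_rpow hδinv hpinv
  have hM1 : 1 ≤ M + 1 := by linarith
  -- This makes `R ^ p = (M + 1) * m / δ`, so that `m * M ≤ δ * R ^ p` and `√m ≤ R ^ (p / 2)`; using
  -- `M + 1` instead of `M` keeps `R ≥ 1`.
  obtain ⟨R, hRdef⟩ : ∃ R, R = (M + 1) ^ (p : ℝ)⁻¹ * X * Y := ⟨_, rfl⟩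
  have hMp : 1 ≤ (M + 1) ^ (p : ℝ)⁻¹ := Real.one_le_rpow hM1 hpinv
  have hR : 1 ≤ R := by
    rw [hRdef]
    exact one_le_mul_of_one_le_of_one_le (one_le_mul_of_one_le_of_one_le hMp hX) hY
  have hRle : R ≤ Q * X * Y := by
    have : (M + 1) ^ (p : ℝ)⁻¹ ≤ Q := by
      calc (M + 1) ^ (p : ℝ)⁻¹ ≤ (M + 1) ^ (1 : ℝ) := Real.rpow_le_rpow_of_exponent_le hM1 hpinv1
        _ ≤ Q := by rwa [Real.rpow_one]
    rw [hRdef]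
    gcongr
  have hRp : R ^ p = (M + 1) * m * (1 / δ) := by
    rw [hRdef, mul_pow, mul_pow, Real.rpow_inv_natCast_pow (by linarith) hp0,
      Real.rpow_inv_natCast_pow hm0.le hp0, Real.rpow_inv_natCast_pow (by positivity) hp0]
  have hlogm : Real.log m ≤ Q * X :=
    (log_le_natCast_mul_rpow_inv hm0 (by omega : 0 < p)).trans (by gcongr)
  have hlogδ : Real.log (1 / δ) ≤ Q * Y :=
    (log_le_natCast_mul_rpow_inv (by positivity) (by omega : 0 < p)).trans (by gcongr)
  have hB₀ : MeasurableSet (Metric.closedBall x₀ (4 * Q)) :=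
    Metric.isClosed_closedBall.measurableSet
  -- Markov's inequality with the first moment `M ≤ Q`.
  have hρB₀ : 3 / 4 ≤ ρ.real (Metric.closedBall x₀ (4 * Q)) := by
    have h1 := hM.pow_mul_measureReal_compl_closedBall_le le_rfl (by omega : 1 ≤ p)
      (by linarith : 0 ≤ 4 * Q)
    rw [probReal_compl_eq_one_sub hB₀, pow_one] at h1
    by_contra! hlt
    nlinarith
  obtain ⟨L, hLdef⟩ : ∃ L, L = Real.log 2 +
      Q ^ 3 * Real.log (2 ^ 21 * (Q ^ 14 * R ^ 6 * m ^ 3)) + Real.log (1 / δ) := ⟨_, rfl⟩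
  have hL0 : 0 ≤ L := by
    have h1 : 0 ≤ Real.log (1 / δ) := Real.log_nonneg hδinv
    have h2 : 0 ≤ Real.log (2 ^ 21 * (Q ^ 14 * R ^ 6 * (m : ℝ) ^ 3)) := by
      refine Real.log_nonneg (one_le_mul_of_one_le_of_one_le (by norm_num) ?_)
      exact one_le_mul_of_one_le_of_one_le (one_le_mul_of_one_le_of_one_le (one_le_pow₀ hQ)
        (one_le_pow₀ hR)) (one_le_pow₀ hm1)
    have h3 : 0 ≤ Real.log 2 := Real.log_nonneg (by norm_num)
    rw [hLdef]; positivity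
  have hLle : L ≤ 46 * (Q ^ 4 * X * Y) :=
    hLdef ▸ log_grid_size_le hQ hX hY hR hRle hm1 hlogm hlogδ
  obtain ⟨G₁, hG₁, hG₁δ, hG₁x⟩ := exists_measurableSet_half_le_empiricalMeasure hm ρ hB₀ hρB₀ hδ hmδ
  obtain ⟨G₂, hG₂, hG₂δ, hG₂x⟩ := exists_measurableSet_forall_mem_closedBall (m := m) (R := R)
    (δ := δ) hM (by omega) (by linarith) (by
      rw [hRp, show δ * ((M + 1) * m * (1 / δ)) = (M + 1) * m * (δ * (1 / δ)) by ring,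
        mul_one_div_cancel hδ.ne', mul_one]
      nlinarith)
  obtain ⟨G₃, hG₃, hG₃δ, hG₃x⟩ := exists_measurableSet_mixtureScore_deviation ρ hm hk x₀ hQ hdQ hkQ
    hR hδ hL0 hLdef.ge
  refine ⟨G₁ ∩ G₂ ∩ G₃, (hG₁.inter hG₂).inter hG₃, ?_, ?_⟩
  · rw [Set.compl_inter, Set.compl_inter]
    calc _ ≤ (Measure.pi fun _ : Fin m => ρ) G₁ᶜ + (Measure.pi fun _ : Fin m => ρ) G₂ᶜ +
          (Measure.pi fun _ : Fin m => ρ) G₃ᶜ :=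
          (measure_union_le _ _).trans (by gcongr; exact measure_union_le _ _)
      _ ≤ ENNReal.ofReal (2 * δ) + ENNReal.ofReal δ + ENNReal.ofReal δ := by gcongr
      _ = ENNReal.ofReal (4 * δ) := by
        rw [← ENNReal.ofReal_add (by positivity) hδ.le, ← ENNReal.ofReal_add (by positivity) hδ.le]
        congr 1; ring
  rintro x ⟨⟨hx₁, hx₂⟩, hx₃⟩ θ hθ
  -- The measure defining the class enters only through its mass on the small ball, so both classes
  -- are handled at once.
  obtain ⟨ν, hν, hνB, hθν⟩ : ∃ ν : Measure (EuclideanSpace ℝ (Fin d)), IsProbabilityMeasure ν ∧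
      1 / 2 ≤ ν.real (Metric.closedBall x₀ (4 * Q)) ∧ θ ∈ mogClass ν c k σ₁ σ₂ := by
    rcases hθ with hθ | hθ
    · exact ⟨_, isProbabilityMeasure_empiricalMeasure hm x, hG₁x x hx₁, hθ⟩
    · exact ⟨ρ, inferInstance, by linarith, hθ⟩
  have hctl : θ.IsControlled Q := MixtureParams.isControlled_of_mem_mogClass hθν hσ₁ hσ₂ hQ
    (by linarith) hkQ hσ₂Q hσ₁Q
  obtain ⟨hsize, -, -, -, hint, hc⟩ := hθν
  obtain ⟨z, hz, hzs⟩ := hctl.exists_mem_le_score hB₀ hνB hcQ hint hc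
  have hgrowth := hctl.abs_score_le (x₀ := x₀) (by simpa [dist_eq_norm] using hz) hzs
  have hintρ : Integrable (mixtureScore θ) ρ :=
    hM.integrable_of_abs_le (by omega) (measurable_mixtureScore θ) hgrowth
  refine ⟨hintρ, ?_⟩
  obtain ⟨q, rfl⟩ := hp4
  have htail := hM.abs_setIntegral_compl_closedBall_le (n := 2 * q) (by omega) (by omega)
    (by positivity) hR hgrowth
  have hdev := hG₃x x hx₃ (hG₂x x hx₂) θ hctl hsize hgrowth
  have hrate := deviation_rate_le hQ hX hY (by linarith) hRle hm0 hLle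
  have hsplit := integral_add_compl (μ := ρ)
    (Metric.isClosed_closedBall (x := x₀) (ε := R)).measurableSet hintρ
  rw [integral_empiricalMeasure, ← hsplit, ← rate_eq hm0 hδ, ← hXdef, ← hYdef]
  have hsqrt : 0 < Real.sqrt m := Real.sqrt_pos.2 hm0
  have hXY : 1 ≤ X ^ 3 * Y ^ 4 :=
    one_le_mul_of_one_le_of_one_le (one_le_pow₀ hX) (one_le_pow₀ hY)
  have hsmall : (4 : ℝ) / m ≤ 4 * Q ^ 8 * (X ^ 3 * Y ^ 4) / Real.sqrt m := by
    have h1 : (1 : ℝ) ≤ Q ^ 8 * (X ^ 3 * Y ^ 4) :=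
      one_le_mul_of_one_le_of_one_le (one_le_pow₀ hQ) hXY
    have h2 : Real.sqrt m ≤ m := Real.sqrt_le_iff.2 ⟨hm0.le, le_self_pow₀ hm1 two_ne_zero⟩
    calc (4 : ℝ) / m ≤ 4 / Real.sqrt m := by gcongr
      _ ≤ _ := by gcongr; linarith
  have htail' : 2 * (100 * Q ^ 4) * M / R ^ (2 * q) ≤
      200 * Q ^ 8 * (X ^ 3 * Y ^ 4) / Real.sqrt m := by
    have h1 : Real.sqrt m ≤ R ^ (2 * q) := by
      rw [Real.sqrt_le_iff]
      refine ⟨by positivity, ?_⟩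
      rw [← pow_mul, show 2 * q * 2 = 4 * q by ring, hRp]
      calc (m : ℝ) = 1 * m * 1 := by ring
        _ ≤ _ := by gcongr
    have h2 : 2 * (100 * Q ^ 4) * M ≤ 200 * Q ^ 8 * (X ^ 3 * Y ^ 4) := by
      calc 2 * (100 * Q ^ 4) * M ≤ 2 * (100 * Q ^ 4) * Q ^ 4 := by
            gcongr
            exact (by linarith : M ≤ Q).trans (le_self_pow₀ hQ (by norm_num))
        _ = 200 * Q ^ 8 * 1 := by ring
        _ ≤ _ := by gcongr
    gcongr
  -- The three parts are the tail, the Hoeffding deviation and the approximation error.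
  have hfinal : 2204 * Q ^ 8 * (X ^ 3 * Y ^ 4 / Real.sqrt m) =
      200 * Q ^ 8 * (X ^ 3 * Y ^ 4) / Real.sqrt m +
        (2000 * Q ^ 8 * (X ^ 3 * Y ^ 4) / Real.sqrt m +
          4 * Q ^ 8 * (X ^ 3 * Y ^ 4) / Real.sqrt m) := by ring
  rw [hfinal]
  rw [abs_le] at *
  constructor <;> linarith [hdev.1, hdev.2, htail.1, htail.2]

end

theorem mainTheorem6 :
    ∃ (C : ℝ) (N : ℕ),
      ∀ (d k p m : ℕ) (M σ₁ σ₂ c δ : ℝ)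
        (ρ : Measure (EuclideanSpace ℝ (Fin d))) [IsProbabilityMeasure ρ],
        8 ≤ p → 4 ∣ p →
        HasMomentBound ρ p M →
        0 < σ₁ → σ₁ ≤ σ₂ → σ₁ ≤ 1 →
        c ≤ 1 / 2 →
        0 < δ →
        ((p : ℝ) / ((2 : ℝ) ^ ((p : ℝ) / 4 + 2) * Real.exp 1)) ^ 2 ≤ (m : ℝ) →
        8 * Real.log (1 / δ) ≤ (m : ℝ) →
        (d : ℝ) ^ 2 * Real.log (Real.pi * σ₂) ^ 2 * Real.log (1 / δ) ≤ (m : ℝ) →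
        ∃ G : Set (Fin m → EuclideanSpace ℝ (Fin d)),
          MeasurableSet G ∧
          ENNReal.ofReal (1 - 5 * δ) ≤ Measure.pi (fun _ : Fin m => ρ) G ∧
          ∀ x ∈ G,
            ∀ θ ∈ mogClass (empiricalMeasure x) c k σ₁ σ₂ ∪ mogClass ρ c k σ₁ σ₂,
              Integrable (mixtureScore θ) ρ ∧
              |∫ y, mixtureScore θ y ∂ρ - ∫ y, mixtureScore θ y ∂(empiricalMeasure x)| ≤
                C * (1 + p + d + k + |c| + M + σ₂ / σ₁ + 1 / σ₁) ^ N *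
                  ((m : ℝ) ^ (-(1 / 2 : ℝ) + 3 / p) *
                    (1 + Real.sqrt (Real.log m + Real.log (1 / δ)) +
                      (1 / δ) ^ (4 / (p : ℝ)))) := by
  refine ⟨2204, 8, ?_⟩
  intro d k p m M σ₁ σ₂ c δ ρ _ hp hp4 hM hσ₁ hσ hσ₁1 _ hδ hmp hmδ _
  -- For `k = 0` both classes are empty, since weights must sum to one.
  rcases Nat.eq_zero_or_pos k with rfl | hk
  · refine ⟨Set.univ, MeasurableSet.univ, ?_, fun x _ θ hθ => ?_⟩
    · rw [measure_univ, ENNReal.ofReal_le_one]; linarith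
    · exact (hθ.elim (not_mem_mogClass_zero θ) (not_mem_mogClass_zero θ)).elim
  rcases lt_or_ge 1 δ with hδ1 | hδ1
  · refine ⟨∅, MeasurableSet.empty, ?_, fun x hx => hx.elim⟩
    rw [ENNReal.ofReal_of_nonpos (by linarith)]
    exact zero_le
  have hm : 0 < m := by
    have hp' : (0 : ℝ) < p := by exact_mod_cast (by omega : 0 < p)
    have : (0 : ℝ) < m := lt_of_lt_of_le (by positivity) hmp
    exact_mod_cast this
  have hM0 : 0 ≤ M := hM.nonneg (by omega)
  have hσ₂ : 0 < σ₂ := hσ₁.trans_le hσ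
  -- As `σ₁ ≤ 1`, the condition number also dominates `σ₂` itself.
  have hσ₂le : σ₂ ≤ σ₂ / σ₁ := le_div_self hσ₂.le hσ₁ hσ₁1
  have hratio : 0 ≤ σ₂ / σ₁ := by positivity
  have hinv : 0 ≤ 1 / σ₁ := by positivity
  have hc := abs_nonneg c
  have hp' : (0 : ℝ) ≤ p := Nat.cast_nonneg p
  have hd' : (0 : ℝ) ≤ d := Nat.cast_nonneg d
  have hk' : (0 : ℝ) ≤ k := Nat.cast_nonneg k
  obtain ⟨Q, hQ⟩ : ∃ Q, Q = 1 + p + d + k + |c| + M + σ₂ / σ₁ + 1 / σ₁ := ⟨_, rfl⟩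
  obtain ⟨G, hG, hGδ, hGx⟩ := exists_measurableSet_mogClass_deviation (c := c) (Q := Q) hp hp4 hM
    hσ₁ hσ₂ hk hm hδ hδ1 hmδ (by linarith) (by linarith) (by linarith) (by linarith) (by linarith)
    (by linarith) (by linarith)
  refine ⟨G, hG, ?_, fun x hx θ hθ => ⟨(hGx x hx θ hθ).1, (hGx x hx θ hθ).2.trans ?_⟩⟩
  · exact (ENNReal.ofReal_le_ofReal (by linarith)).trans
      (ofReal_le_measure_of_compl_le hG (by positivity) hGδ)
  · rw [← hQ]
    have hQ0 : 0 ≤ Q := by rw [hQ]; positivity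
    gcongr
    -- The summand `(1 / δ) ^ (4 / p)` alone already dominates the bound obtained.
    linarith [Real.sqrt_nonneg (Real.log m + Real.log (1 / δ))]
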